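/- Theorem 1. Let $X\subset\mathbb R^d$ be compact and let $K:X\times X\to\mathbb R$ be a Mercer kernel (continuous, symmetric, positive semidefinite) with $K(x,x)\le 1$ for all $x\in X$. Let $\mathcal H_K$ be its reproducing kernel Hilbert space, with norm $\|\cdot\|$. Let $\rho$ be a probability measure on $X\times\mathbb R$ whose labels lie almost surely in $[-Y,Y]$, with marginal $\rho_X$ on $X$. Write $\mathcal R(f)=\int (f(x)-y)^2\,d\rho(x,y)$, $f_\rho(x)=\int y\,d\rho(y|x)$, and let $L_K$ be the integral operator $(L_Kf)(x)=\int K(x,x')f(x')\,d\rho_X(x')$ on $L^2(\rho_X)$, with norm $\|\cdot\|_\rho$ on this space. Assume that $f_\rho\in L_K^{\beta}(L^2(\rho_X))$ for some $0<\beta\le\frac12$, and let $\|L_K^{-\beta}f_\rho\|_\rho$ be the least norm of a $g\in L^2(\rho_X)$ with $f_\rho=L_K^\beta g$. Assume that $\mathrm{Tr}[L_K^b]<\infty$ for some $b\in[0,1]$, where $\mathrm{Tr}[L_K^b]$ is the sum of $t^b$ over the positive eigenvalues $t$ of $L_K$, counted with multiplicity. Let $\lambda>0$ and $n\ge1$.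 On a training set $S=((x_i,y_i))_{i=1}^n$, the algorithm KTR$^3$ permutes $S$ uniformly at random, draws $k$ uniformly from $\{0,\dots,n-1\}$ (independently), and returns $f_{S,\lambda}=T^Y\circ f_k$, where $$f_k=\operatorname*{argmin}_{f\in\mathcal H_K}\ \lambda\|f\|^2+\frac1n\sum_{i=1}^k (f(x_i)-y_i)^2$$ is computed on the first $k$ elements of the permuted set and $T^Y(z)=\min(Y,|z|)\,\mathrm{sign}(z)$. Then, with the expectation over $S\sim\rho^n$ and over the randomization of the algorithm, $\mathbb E[\mathcal R(f_{S,\lambda})]$ exists and $$\mathbb E[\mathcal R(f_{S,\lambda})]-\mathcal R(f_\rho)\le \lambda^{2\beta}\|L_K^{-\beta}f_\rho\|_\rho^2+\min\left[\frac{4Y^2\,\mathrm{Tr}[L_K^b]}{\lambda^b n}\min\left(\ln^{1-b}\left(1+\frac1\lambda\right),\frac1b\right),\ \frac{\lambda^{2\beta-1}\|L_K^{-\beta}f_\rho\|_\rho^2}{n}+\frac{\mathcal R(f_\rho)}{\lambda n}\right],$$ where $\frac1b=+\infty$ if $b=0$. -/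

import Mathlib

open MeasureTheory

noncomputable section

namespace KTR

/-- A Mercer kernel on `X`: a continuous, symmetric, positive semidefinite function
`K : X × X → ℝ` (symmetry is part of `Matrix.PosSemidef`). -/
structure MercerKernel (X : Type*) [TopologicalSpace X] where
  /-- the underlying function of two variables -/
  toFun : X → X → ℝ
  continuous_toFun : Continuous (fun p : X × X => toFun p.1 p.2)
  posSemidef_toFun : (Matrix.of toFun).PosSemidef

instance {X : Type*} [TopologicalSpace X] : CoeFun (MercerKernel X) (fun _ => X → X → ℝ) :=
  ⟨MercerKernel.toFun⟩

section IntegralOperator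

variable {X : Type*} [TopologicalSpace X] [CompactSpace X] [MeasurableSpace X] [BorelSpace X]

/-- The section `K(x, ·)` as a continuous function, depending continuously on `x`. -/
def MercerKernel.sec (K : MercerKernel X) : C(X, C(X, ℝ)) :=
  ContinuousMap.curry ⟨fun p : X × X => K p.1 p.2, K.continuous_toFun⟩

theorem MercerKernel.integral_eq_inner (K : MercerKernel X) (μ : Measure X) [IsFiniteMeasure μ]
    (f : Lp ℝ 2 μ) (x : X) :
    ∫ x', K x x' * f x' ∂μ = inner ℝ (ContinuousMap.toLp (E := ℝ) 2 μ ℝ (K.sec x)) f := by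
  rw [L2.inner_def]
  refine integral_congr_ae ?_
  filter_upwards [ContinuousMap.coeFn_toLp (p := 2) (𝕜 := ℝ) μ (K.sec x)] with x' hx'
  rw [hx']
  simp [MercerKernel.sec, mul_comm]

theorem MercerKernel.integrable_mul (K : MercerKernel X) (μ : Measure X) [IsFiniteMeasure μ]
    (f : Lp ℝ 2 μ) (x : X) : Integrable (fun x' => K x x' * f x') μ := by
  refine (L2.integrable_inner (𝕜 := ℝ)
    (ContinuousMap.toLp (E := ℝ) 2 μ ℝ (K.sec x)) f).congr ?_
  filter_upwards [ContinuousMap.coeFn_toLp (p := 2) (𝕜 := ℝ) μ (K.sec x)] with x' hx'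
  rw [hx']
  simp [MercerKernel.sec, mul_comm]

/-- `f ↦ (x ↦ ∫ K(x, x') f(x') dμ(x'))` as a bounded operator from `L²(μ)` to `C(X)`. -/
def MercerKernel.integralOpC (K : MercerKernel X) (μ : Measure X) [IsFiniteMeasure μ] :
    Lp ℝ 2 μ →L[ℝ] C(X, ℝ) :=
  LinearMap.mkContinuous
    { toFun := fun f =>
        { toFun := fun x => ∫ x', K x x' * f x' ∂μ
          continuous_toFun := by
            simp_rw [K.integral_eq_inner μ f]
            fun_prop }
      map_add' := fun f g => by
        ext x
        simp only [ContinuousMap.coe_mk, ContinuousMap.add_apply, K.integral_eq_inner,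
          inner_add_right]
      map_smul' := fun c f => by
        ext x
        simp only [ContinuousMap.coe_mk, ContinuousMap.smul_apply, K.integral_eq_inner,
          inner_smul_right, RingHom.id_apply, smul_eq_mul] }
    (‖ContinuousMap.toLp (E := ℝ) 2 μ ℝ‖ * ‖K.sec‖)
    (fun f => by
      refine (ContinuousMap.norm_le _ (by positivity)).2 fun x => ?_
      simp only [LinearMap.coe_mk, AddHom.coe_mk, ContinuousMap.coe_mk, K.integral_eq_inner]
      refine (norm_inner_le_norm _ _).trans ?_
      gcongr
      refine (ContinuousLinearMap.le_opNorm _ _).trans ?_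
      gcongr
      exact K.sec.norm_coe_le_norm x)

/-- The integral operator `L_K : L²(μ) → L²(μ)`, `(L_K f)(x) = ∫ K(x, x') f(x') dμ(x')`. -/
def integralOp (K : MercerKernel X) (μ : Measure X) [IsFiniteMeasure μ] :
    Lp ℝ 2 μ →L[ℝ] Lp ℝ 2 μ :=
  ContinuousMap.toLp (E := ℝ) 2 μ ℝ ∘L K.integralOpC μ

theorem integralOp_apply_ae (K : MercerKernel X) (μ : Measure X) [IsFiniteMeasure μ]
    (f : Lp ℝ 2 μ) : integralOp K μ f =ᵐ[μ] fun x => ∫ x', K x x' * f x' ∂μ :=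
  ContinuousMap.coeFn_toLp (p := 2) (𝕜 := ℝ) μ (K.integralOpC μ f)

end IntegralOperator

section Powers

variable {E : Type*} [NormedAddCommGroup E] [InnerProductSpace ℝ E]

/-- The eigenspace `{f | T f = t f}` of a bounded operator. -/
def eigenspace (T : E →L[ℝ] E) (t : ℝ) : Submodule ℝ E :=
  (T - t • ContinuousLinearMap.id ℝ E).ker

theorem mem_eigenspace (T : E →L[ℝ] E) (t : ℝ) (f : E) : f ∈ eigenspace T t ↔ T f = t • f := by
  simp [eigenspace, sub_eq_zero]

instance [CompleteSpace E] (T : E →L[ℝ] E) (t : ℝ) : CompleteSpace (eigenspace T t) :=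
  inferInstanceAs (CompleteSpace (T - t • ContinuousLinearMap.id ℝ E).ker)

/-- The power `T ^ s`, `s > 0`, of a compact positive operator, through its spectral decomposition:
`T ^ s g = ∑ t ^ s • P_t g` over the positive eigenvalues `t`, where `P_t` is the orthogonal
projection onto the eigenspace of `t`. The sum runs over all `t > 0`; those that are not
eigenvalues contribute `0`, and so would the eigenvalue `0`, because `s > 0`. -/
def powApply [CompleteSpace E] (T : E →L[ℝ] E) (s : ℝ) (g : E) : E :=
  ∑' t : Set.Ioi (0 : ℝ), (t : ℝ) ^ s • (eigenspace T t).starProjection g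

/-- `Tr[T ^ s]`, `s ≥ 0`, of a compact positive operator: the sum, in `[0, ∞]`, of `t ^ s` over
the positive eigenvalues `t`, counted with multiplicity. (For `s = 0` it is the rank of `T`.) -/
def tracePow (T : E →L[ℝ] E) (s : ℝ) : ENNReal :=
  ∑' t : Set.Ioi (0 : ℝ), (Module.finrank ℝ (eigenspace T t) : ENNReal) * ENNReal.ofReal ((t : ℝ) ^ s)

end Powers

section Source

variable {X : Type*} [TopologicalSpace X] [CompactSpace X] [MeasurableSpace X] [BorelSpace X]

/-- The `g ∈ L²(μ)` with `f = L_K ^ β g` `μ`-almost everywhere. -/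
def sourceElements (K : MercerKernel X) (μ : Measure X) [IsFiniteMeasure μ] (β : ℝ) (f : X → ℝ) :
    Set (Lp ℝ 2 μ) :=
  {g | f =ᵐ[μ] (powApply (integralOp K μ) β g : Lp ℝ 2 μ)}

/-- `f ∈ L_K ^ β (L²(μ))`. -/
def SourceCondition (K : MercerKernel X) (μ : Measure X) [IsFiniteMeasure μ] (β : ℝ)
    (f : X → ℝ) : Prop :=
  (sourceElements K μ β f).Nonempty

/-- `‖L_K ^ (-β) f‖` in `L²(μ)`: the least norm of a `g` with `f = L_K ^ β g` (`g` is unique only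
up to the null space of `L_K`). -/
def sourceNorm (K : MercerKernel X) (μ : Measure X) [IsFiniteMeasure μ] (β : ℝ) (f : X → ℝ) : ℝ :=
  sInf (norm '' sourceElements K μ β f)

end Source

section Learning

variable {X : Type*} [MeasurableSpace X]

/-- The risk `∫ (f(x) - y)² dρ(x, y)`. -/
def risk (ρ : Measure (X × ℝ)) (f : X → ℝ) : ℝ :=
  ∫ z, (f z.1 - z.2) ^ 2 ∂ρ

/-- The regression function `f_ρ(x) = ∫ y dρ(y | x)`. -/
def regressionFun (ρ : Measure (X × ℝ)) [IsFiniteMeasure ρ] (x : X) : ℝ :=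
  ∫ y, y ∂(ρ.condKernel x)

/-- The truncation `T^Y(z) = min(Y, |z|) sign(z)`. -/
def truncate (Y z : ℝ) : ℝ :=
  min Y |z| * Real.sign z

end Learning

section Algorithm

variable {X : Type*} (H : Type*) [NormedAddCommGroup H] [InnerProductSpace ℝ H] [RKHS ℝ H X ℝ]

/-- The objective `lam ‖f‖² + (1/n) ∑ (f(x_i) - y_i)²`, the sum over the first `k` of the `n`
examples. -/
def ridgeObjective {n : ℕ} (lam : ℝ) (S : Fin n → X × ℝ) (k : Fin n) (f : H) : ℝ :=
  lam * ‖f‖ ^ 2 + 1 / (n : ℝ) * ∑ i ∈ Finset.Iio k, (f (S i).1 - (S i).2) ^ 2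

/-- `f` minimizes the objective, and has the least norm among all minimizers. -/
def IsRidgeSolution {n : ℕ} (lam : ℝ) (S : Fin n → X × ℝ) (k : Fin n) (f : H) : Prop :=
  (∀ g : H, ridgeObjective H lam S k f ≤ ridgeObjective H lam S k g) ∧
    ∀ g : H, (∀ h : H, ridgeObjective H lam S k g ≤ ridgeObjective H lam S k h) → ‖f‖ ≤ ‖g‖

/-- The candidate `f_k`, `k = 0, …, n - 1`. -/
def ridge {n : ℕ} (lam : ℝ) (S : Fin n → X × ℝ) (k : Fin n) : H :=
  Classical.epsilon (IsRidgeSolution H lam S k)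

/-- The predictor that KTR³ returns on the training set `S`, when `σ` is the permutation and `k`
the index that it has drawn. -/
def ktrOutput {n : ℕ} (lam Y : ℝ) (S : Fin n → X × ℝ) (σ : Equiv.Perm (Fin n)) (k : Fin n) :
    X → ℝ :=
  fun x => truncate Y (ridge H lam (S ∘ σ) k x)

/-- The risk of the output of KTR³ on `S`, averaged over the randomization of the algorithm:
`σ` uniform among the permutations of the training set, `k` uniform in `{0, …, n - 1}`,
independent. -/
def ktrMeanRisk [MeasurableSpace X] {n : ℕ} (ρ : Measure (X × ℝ)) (lam Y : ℝ)
    (S : Fin n → X × ℝ) : ℝ :=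
  1 / (n.factorial : ℝ) * ∑ σ : Equiv.Perm (Fin n),
    1 / (n : ℝ) * ∑ k : Fin n, risk ρ (ktrOutput H lam Y S σ k)

end Algorithm

/-- `min(ln^{1-b}(1 + 1/lam), 1/b)`, where `1/b = +∞` for `b = 0`. -/
def logFactor (b lam : ℝ) : ℝ :=
  if b = 0 then Real.log (1 + 1 / lam)
  else min (Real.log (1 + 1 / lam) ^ (1 - b)) (1 / b)

end KTR

end

/-! The proof is an online-to-batch conversion. The candidate `f_k` is trained on the examples
before the `k`-th, so its expected risk is its expected loss on example `k`. Hence the expected risk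
of the algorithm is `1/n` times the expected cumulative loss of online ridge regression with
parameter `μ = λn` (`integral_ktrMeanRisk`).

Let `h_k` be the leverage of example `k` among the examples `0, …, k`. The regret inequality
`sum_sq_le_ridgeCost` bounds `∑ (1 - h_k) (f_k(x_k) - y_k)²` by `μ‖u‖² + ∑ (u(x_i) - y_i)²` for
every `u ∈ H`. In expectation, divided by `n`, the bound is `λ‖u‖² + R(u)`. Tikhonov regularization
of `f_ρ` supplies a `u` for which this is at most `R(f_ρ) + λ^{2β} ‖L_K^{-β} f_ρ‖²`
(`exists_regularized_risk_le`).

Two ways to remove the weights `1 - h_k` give the two members of the minimum. Truncated losses are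
at most `4Y²`, which costs `4Y² ∑ h_k`; or `h_k ≤ 1/(1+μ)`, which costs the factor `1 + 1/μ`.

To bound `E ∑ h_k`, exchangeability makes `(k+1) E h_k` the expected effective dimension of `k+1`
examples. A Jensen-type inequality in an eigenbasis of the covariance, with eigenvalues `t_j`, gives
`E h_k ≤ ∑_j t_j / (μ + (k+1) t_j)`. The sum over `k` is at most `∑_j ln(1 + t_j/λ)`, which is
compared with `Tr[L_K^b]` term by term. -/

noncomputable section

namespace KTR

/-! ### Ridge regression in a Hilbert space: leverage, regret and effective dimension -/

section RidgeAlgebra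

variable {ι : Type*} {E : Type*} [NormedAddCommGroup E] [InnerProductSpace ℝ E]

/-- The regularized empirical covariance operator `μ + ∑ i ∈ s, v i ⊗ v i`. -/
def ridgeOp (μ : ℝ) (s : Finset ι) (v : ι → E) : E →L[ℝ] E :=
  μ • (1 : E →L[ℝ] E) + ∑ i ∈ s, InnerProductSpace.rankOne ℝ (v i) (v i)

theorem ridgeOp_apply (μ : ℝ) (s : Finset ι) (v : ι → E) (u : E) :
    ridgeOp μ s v u = μ • u + ∑ i ∈ s, inner ℝ (v i) u • v i := by
  simp [ridgeOp]

theorem inner_ridgeOp (μ : ℝ) (s : Finset ι) (v : ι → E) (u w : E) :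
    inner ℝ (ridgeOp μ s v u) w
      = μ * inner ℝ u w + ∑ i ∈ s, inner ℝ (v i) u * inner ℝ (v i) w := by
  simp [ridgeOp_apply, inner_add_left, sum_inner, inner_smul_left]

theorem inner_ridgeOp_comm (μ : ℝ) (s : Finset ι) (v : ι → E) (u w : E) :
    inner ℝ (ridgeOp μ s v u) w = inner ℝ u (ridgeOp μ s v w) := by
  rw [real_inner_comm (ridgeOp μ s v w) u, inner_ridgeOp, inner_ridgeOp, real_inner_comm w u]
  simp [mul_comm]

theorem inner_ridgeOp_self (μ : ℝ) (s : Finset ι) (v : ι → E) (u : E) :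
    inner ℝ (ridgeOp μ s v u) u = μ * ‖u‖ ^ 2 + ∑ i ∈ s, inner ℝ (v i) u ^ 2 := by
  simp [inner_ridgeOp, sq]

theorem le_inner_ridgeOp_self (μ : ℝ) (s : Finset ι) (v : ι → E) (u : E) :
    μ * ‖u‖ ^ 2 ≤ inner ℝ (ridgeOp μ s v u) u := by
  rw [inner_ridgeOp_self]
  have : 0 ≤ ∑ i ∈ s, inner ℝ (v i) u ^ 2 := Finset.sum_nonneg fun i _ => sq_nonneg _
  linarith

theorem continuous_ridgeOp (μ : ℝ) (s : Finset ι) :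
    Continuous fun v : ι → E => ridgeOp μ s v := by
  unfold ridgeOp
  simp only [InnerProductSpace.rankOne_def]
  refine continuous_const.add (continuous_finsetSum _ fun i _ => ?_)
  have h : Continuous fun w : E => InnerProductSpace.rankOne ℝ w w := by
    exact ((InnerProductSpace.rankOne ℝ (E := E) (F := E)).continuous).clm_apply continuous_id
  exact h.comp (continuous_apply i)

/-- The regularized sum of squares `μ ‖f‖² + ∑ i ∈ s, (⟪v i, f⟫ - y i)²`. -/
def ridgeCost (μ : ℝ) (s : Finset ι) (v : ι → E) (y : ι → ℝ) (f : E) : ℝ :=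
  μ * ‖f‖ ^ 2 + ∑ i ∈ s, (inner ℝ (v i) f - y i) ^ 2

theorem ridgeCost_eq_inner (μ : ℝ) (s : Finset ι) (v : ι → E) (y : ι → ℝ) (f : E) :
    ridgeCost μ s v y f
      = inner ℝ (ridgeOp μ s v f) f - 2 * inner ℝ (∑ i ∈ s, y i • v i) f + ∑ i ∈ s, y i ^ 2 := by
  simp only [ridgeCost, inner_ridgeOp_self, sum_inner, inner_smul_left, sub_sq,
    Finset.sum_add_distrib, Finset.sum_sub_distrib, Finset.mul_sum, RCLike.conj_to_real]
  have : ∀ i, 2 * inner ℝ (v i) f * y i = 2 * (y i * inner ℝ (v i) f) := fun i => by ring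
  simp only [this]
  ring

variable [CompleteSpace E]

theorem isUnit_ridgeOp {μ : ℝ} (hμ : 0 < μ) (s : Finset ι) (v : ι → E) :
    IsUnit (ridgeOp μ s v) := by
  refine ContinuousLinearMap.isUnit_of_forall_le_norm_inner_map _ (c := ⟨μ, hμ.le⟩) hμ fun u => ?_
  refine le_trans ?_ ((le_inner_ridgeOp_self μ s v u).trans (le_abs_self _))
  rw [mul_comm]
  rfl

/-- The inverse of the regularized empirical covariance operator. -/
def ridgeInv (μ : ℝ) (s : Finset ι) (v : ι → E) : E →L[ℝ] E :=
  Ring.inverse (ridgeOp μ s v)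

theorem ridgeOp_ridgeInv {μ : ℝ} (hμ : 0 < μ) (s : Finset ι) (v : ι → E) (u : E) :
    ridgeOp μ s v (ridgeInv μ s v u) = u :=
  congrArg (fun T : E →L[ℝ] E => T u) (Ring.mul_inverse_cancel _ (isUnit_ridgeOp hμ s v))

theorem ridgeInv_ridgeOp {μ : ℝ} (hμ : 0 < μ) (s : Finset ι) (v : ι → E) (u : E) :
    ridgeInv μ s v (ridgeOp μ s v u) = u :=
  congrArg (fun T : E →L[ℝ] E => T u) (Ring.inverse_mul_cancel _ (isUnit_ridgeOp hμ s v))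

theorem continuous_ridgeInv {μ : ℝ} (hμ : 0 < μ) (s : Finset ι) :
    Continuous fun v : ι → E => ridgeInv μ s v := by
  refine continuous_iff_continuousAt.2 fun v => ?_
  obtain ⟨u, hu⟩ := isUnit_ridgeOp hμ s v
  have h := NormedRing.inverse_continuousAt u
  rw [hu] at h
  exact ContinuousAt.comp (f := fun v : ι → E => ridgeOp μ s v) h
    (continuous_ridgeOp μ s).continuousAt

/-- The leverage score `⟪v i, (μ + ∑ j ∈ s, v j ⊗ v j)⁻¹ v i⟫`. -/
def leverage (μ : ℝ) (s : Finset ι) (v : ι → E) (i : ι) : ℝ :=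
  inner ℝ (ridgeInv μ s v (v i)) (v i)

theorem leverage_eq_inner_ridgeOp {μ : ℝ} (hμ : 0 < μ) (s : Finset ι) (v : ι → E) (i : ι) :
    leverage μ s v i
      = inner ℝ (ridgeOp μ s v (ridgeInv μ s v (v i))) (ridgeInv μ s v (v i)) := by
  rw [ridgeOp_ridgeInv hμ, leverage, real_inner_comm]

theorem leverage_nonneg {μ : ℝ} (hμ : 0 < μ) (s : Finset ι) (v : ι → E) (i : ι) :
    0 ≤ leverage μ s v i := by
  rw [leverage_eq_inner_ridgeOp hμ]
  exact (by positivity : (0 : ℝ) ≤ μ * _).trans (le_inner_ridgeOp_self μ s v _)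

theorem continuous_leverage {μ : ℝ} (hμ : 0 < μ) (s : Finset ι) (i : ι) :
    Continuous fun v : ι → E => leverage μ s v i := by
  unfold leverage
  exact ((continuous_ridgeInv hμ s).clm_apply (continuous_apply i)).inner (continuous_apply i)

/-- With `u = A⁻¹ (v i)`, keeping only the `i`-th square in `⟪A u, u⟫ = h` gives `μ‖u‖² + h² ≤ h`.
Since `h ≤ ‖u‖`, this yields `(1 + μ) h² ≤ h`. -/
theorem leverage_le {μ : ℝ} (hμ : 0 < μ) {s : Finset ι} {v : ι → E} {i : ι} (hi : i ∈ s)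
    (hv : ‖v i‖ ≤ 1) : leverage μ s v i ≤ 1 / (1 + μ) := by
  set u := ridgeInv μ s v (v i)
  set h := leverage μ s v i with hh
  have h0 : 0 ≤ h := leverage_nonneg hμ s v i
  have hhu : h = inner ℝ (v i) u := by rw [hh, leverage, real_inner_comm]
  have h1 : μ * ‖u‖ ^ 2 + h ^ 2 ≤ h := by
    conv_rhs => rw [hh, leverage_eq_inner_ridgeOp hμ, inner_ridgeOp_self]
    rw [hhu]
    gcongr
    exact Finset.single_le_sum (f := fun j => inner ℝ (v j) u ^ 2) (fun j _ => sq_nonneg _) hi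
  have h2 : h ≤ ‖u‖ := by
    rw [hhu]
    refine (real_inner_le_norm _ _).trans ?_
    exact mul_le_of_le_one_left (norm_nonneg _) hv
  have h3 : h ^ 2 ≤ ‖u‖ ^ 2 := by gcongr
  rw [le_div_iff₀ (by linarith)]
  by_contra! hc
  have hpos : 0 < h := by
    rcases h0.lt_or_eq with h4 | h4
    · exact h4
    · rw [← h4] at hc; linarith
  nlinarith [mul_le_mul_of_nonneg_left h3 hμ.le, mul_lt_mul_of_pos_left hc hpos]

/-- Cauchy-Schwarz in the inner product given by the regularized covariance operator. -/
theorem inner_sq_le_leverage_mul {μ : ℝ} (hμ : 0 < μ) (s : Finset ι) (v : ι → E) (i : ι) (d : E) :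
    inner ℝ (v i) d ^ 2 ≤ leverage μ s v i * inner ℝ (ridgeOp μ s v d) d := by
  set A := ridgeOp μ s v
  set u := ridgeInv μ s v (v i) with hu
  have hAu : A u = v i := ridgeOp_ridgeInv hμ s v _
  -- The form of `A` is nonnegative at `x • d + u` for all real `x`, so the discriminant of this
  -- quadratic in `x` is nonpositive.
  have key : ∀ x : ℝ, 0 ≤ inner ℝ (A d) d * (x * x)
      + (2 * inner ℝ (v i) d) * x + leverage μ s v i := fun x => by
    have h := (by positivity : (0 : ℝ) ≤ μ * _).trans (le_inner_ridgeOp_self μ s v (x • d + u))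
    change 0 ≤ inner ℝ (A (x • d + u)) (x • d + u) at h
    have e1 : inner ℝ (A d) u = inner ℝ (v i) d := by
      rw [inner_ridgeOp_comm, real_inner_comm]
      change inner ℝ (A u) d = _
      rw [hAu]
    have e2 : inner ℝ (v i) u = leverage μ s v i := by rw [leverage, real_inner_comm]
    simp only [map_add, map_smul, inner_add_left, inner_add_right, inner_smul_left,
      inner_smul_right, hAu, e1, e2, RCLike.conj_to_real] at h
    linarith
  have := discrim_le_zero key
  rw [discrim] at this
  linarith

/-- The minimizer of `f ↦ μ ‖f‖² + ∑ i ∈ s, (⟪v i, f⟫ - y i)²`. -/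
def ridgeSol (μ : ℝ) (s : Finset ι) (v : ι → E) (y : ι → ℝ) : E :=
  ridgeInv μ s v (∑ i ∈ s, y i • v i)

theorem ridgeOp_ridgeSol {μ : ℝ} (hμ : 0 < μ) (s : Finset ι) (v : ι → E) (y : ι → ℝ) :
    ridgeOp μ s v (ridgeSol μ s v y) = ∑ i ∈ s, y i • v i :=
  ridgeOp_ridgeInv hμ s v _

/-- Completing the square: the normal equation cancels the linear term. Uniqueness of the minimizer
and the regret inequality both rest on this identity. -/
theorem ridgeCost_eq_ridgeSol_add {μ : ℝ} (hμ : 0 < μ) (s : Finset ι) (v : ι → E) (y : ι → ℝ)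
    (f : E) :
    ridgeCost μ s v y f = ridgeCost μ s v y (ridgeSol μ s v y)
      + inner ℝ (ridgeOp μ s v (f - ridgeSol μ s v y)) (f - ridgeSol μ s v y) := by
  have h := ridgeOp_ridgeSol hμ s v y
  rw [ridgeCost_eq_inner, ridgeCost_eq_inner]
  simp only [map_sub, inner_sub_left, inner_sub_right, ← h]
  rw [inner_ridgeOp_comm μ s v f (ridgeSol μ s v y),
    real_inner_comm (ridgeOp μ s v (ridgeSol μ s v y)) f]
  ring

theorem ridgeCost_ridgeSol_add_le {μ : ℝ} (hμ : 0 < μ) (s : Finset ι) (v : ι → E) (y : ι → ℝ)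
    (f : E) :
    ridgeCost μ s v y (ridgeSol μ s v y) + μ * ‖f - ridgeSol μ s v y‖ ^ 2
      ≤ ridgeCost μ s v y f := by
  rw [ridgeCost_eq_ridgeSol_add hμ s v y f]
  gcongr
  exact le_inner_ridgeOp_self μ s v _

/-- Adding one example increases the minimal cost by at least the squared prediction error on it,
discounted by its leverage. -/
theorem ridgeCost_insert_ge [DecidableEq ι] {μ : ℝ} (hμ : 0 < μ) {s : Finset ι} {v : ι → E}
    (y : ι → ℝ) {k : ι} (hk : k ∉ s) (f : E) :
    ridgeCost μ s v y (ridgeSol μ s v y)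
        + (1 - leverage μ (insert k s) v k) * (inner ℝ (v k) (ridgeSol μ s v y) - y k) ^ 2
      ≤ ridgeCost μ (insert k s) v y f := by
  set h := leverage μ (insert k s) v k with hh
  set p := ridgeSol μ s v y with hp
  set d := f - p with hd
  set c := inner ℝ (v k) d with hc
  set r := inner ℝ (v k) p - y k with hr
  have e1 : ridgeCost μ (insert k s) v y f
      = ridgeCost μ s v y p + inner ℝ (ridgeOp μ s v d) d + (r + c) ^ 2 := by
    rw [← ridgeCost_eq_ridgeSol_add hμ s v y f, ridgeCost, ridgeCost, Finset.sum_insert hk]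
    have : r + c = inner ℝ (v k) f - y k := by
      rw [hr, hc, hd, inner_sub_right]; ring
    rw [this]
    ring
  have e2 : inner ℝ (ridgeOp μ (insert k s) v d) d = inner ℝ (ridgeOp μ s v d) d + c ^ 2 := by
    rw [inner_ridgeOp_self, inner_ridgeOp_self, Finset.sum_insert hk]
    ring
  have h1 : c ^ 2 ≤ h * (inner ℝ (ridgeOp μ s v d) d + c ^ 2) := by
    rw [← e2]; exact inner_sq_le_leverage_mul hμ _ v k d
  have h0 : 0 ≤ h := leverage_nonneg hμ _ v k
  have hQ : 0 ≤ inner ℝ (ridgeOp μ s v d) d :=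
    (by positivity : (0 : ℝ) ≤ μ * _).trans (le_inner_ridgeOp_self μ s v _)
  rw [e1]
  suffices (1 - h) * r ^ 2 ≤ inner ℝ (ridgeOp μ s v d) d + (r + c) ^ 2 by linarith
  rcases h0.lt_or_eq with hpos | h0
  -- After multiplication by `h`, the bound `h1` leaves the remainder `(c + h r)² ≥ 0`. If `h = 0`,
  -- then `h1` forces `c = 0`.
  · refine le_of_mul_le_mul_left ?_ hpos
    nlinarith [sq_nonneg (c + h * r)]
  · rw [← h0] at h1 ⊢
    have : c = 0 := by
      have : c ^ 2 = 0 := le_antisymm (by simpa using h1) (sq_nonneg c)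
      simpa using this
    rw [this]
    simp [hQ]

/-- The regret inequality of online ridge regression. -/
theorem sum_sq_le_ridgeCost {n : ℕ} {μ : ℝ} (hμ : 0 < μ) (v : Fin n → E) (y : Fin n → ℝ) (f : E) :
    ∑ k, (1 - leverage μ (Finset.Iic k) v k)
        * (inner ℝ (v k) (ridgeSol μ (Finset.Iio k) v y) - y k) ^ 2
      ≤ ridgeCost μ Finset.univ v y f := by
  -- Induction on the length of the prefix. The comparator `f` is kept general because the induction
  -- hypothesis is applied at the ridge solution of the shorter prefix, while `ridgeCost_insert_ge`
  -- accounts for the new example.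
  suffices H : ∀ m : ℕ, m ≤ n → ∀ f : E,
      ∑ k with k.val < m, (1 - leverage μ (Finset.Iic k) v k)
        * (inner ℝ (v k) (ridgeSol μ (Finset.Iio k) v y) - y k) ^ 2
      ≤ ridgeCost μ {k | k.val < m} v y f by
    have := H n le_rfl f
    simpa using this
  intro m
  induction m with
  | zero => intro _ f; simp [ridgeCost]; positivity
  | succ m ih =>
    intro hm f
    set k : Fin n := ⟨m, hm⟩ with hk
    have e1 : (Finset.univ.filter fun i : Fin n => i.val < m) = Finset.Iio k := by
      ext i; simp [Fin.lt_def, hk]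
    have e2 : (Finset.univ.filter fun i : Fin n => i.val < m + 1) = insert k (Finset.Iio k) := by
      ext i; simp [hk, Fin.le_def]
    have e3 : insert k (Finset.Iio k) = Finset.Iic k := by
      ext i; simp [le_iff_eq_or_lt]
    have ih' := ih (by omega) (ridgeSol μ (Finset.Iio k) v y)
    rw [e1] at ih'
    have hk' : k ∉ Finset.Iio k := by simp
    rw [e2, Finset.sum_insert hk']
    have := ridgeCost_insert_ge hμ (v := v) y hk' f
    rw [e3] at this ⊢
    linarith

/-- The effective dimension `∑ i ∈ s, leverage i`, written in a Hilbert basis. -/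
theorem hasSum_sum_leverage {κ : Type*} (e : HilbertBasis κ ℝ E) {μ : ℝ} (hμ : 0 < μ)
    (s : Finset ι) (v : ι → E) :
    HasSum (fun j => 1 - μ * inner ℝ (ridgeInv μ s v (e j)) (e j))
      (∑ i ∈ s, leverage μ s v i) := by
  have h := hasSum_sum (s := s) fun i _ => e.hasSum_inner_mul_inner (ridgeInv μ s v (v i)) (v i)
  convert! h using 2 with j
  have h1 : ‖e j‖ = 1 := e.orthonormal.1 j
  -- Pairing `A⁻¹ A e_j = e_j` with `e_j` identifies the `j`-th term of the Parseval sum as `1 - μ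
  -- ⟪A⁻¹ e_j, e_j⟫`.
  have h2 : ridgeInv μ s v (ridgeOp μ s v (e j)) = e j := ridgeInv_ridgeOp hμ s v _
  rw [ridgeOp_apply, map_add, map_smul, map_sum] at h2
  have h3 := congrArg (fun u => inner ℝ u (e j)) h2
  simp only [inner_add_left, inner_smul_left, sum_inner, map_smul, RCLike.conj_to_real,
    real_inner_self_eq_norm_sq, h1] at h3
  have h4 : ∀ i, inner ℝ (ridgeInv μ s v (v i)) (e j) * inner ℝ (e j) (v i)
      = inner ℝ (v i) (e j) * inner ℝ (ridgeInv μ s v (v i)) (e j) := fun i => by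
    rw [mul_comm, real_inner_comm (v i)]
  simp only [h4]
  linarith

theorem one_sub_inner_ridgeInv_nonneg {μ : ℝ} (hμ : 0 < μ) (s : Finset ι) (v : ι → E) {e : E}
    (he : ‖e‖ = 1) : 0 ≤ 1 - μ * inner ℝ (ridgeInv μ s v e) e := by
  have h := le_inner_ridgeOp_self μ s v (ridgeInv μ s v e)
  rw [ridgeOp_ridgeInv hμ] at h
  set u := ridgeInv μ s v e
  have h1 : inner ℝ u e ≤ ‖u‖ := by simpa [he] using real_inner_le_norm u e
  rw [real_inner_comm] at h
  nlinarith [norm_nonneg u, sq_nonneg (μ * ‖u‖ - 1)]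

/-- Positivity of the form at `(c/μ) e - A⁻¹ e`. The right side is affine in the squares `⟪v i,
e⟫²`, so its expectation is explicit, and a deterministic `c` can be optimized afterwards; this
replaces Jensen's inequality for the operator inverse. -/
theorem one_sub_inner_ridgeInv_le {μ : ℝ} (hμ : 0 < μ) (s : Finset ι) (v : ι → E) {e : E}
    (he : ‖e‖ = 1) (c : ℝ) :
    1 - μ * inner ℝ (ridgeInv μ s v e) e
      ≤ (1 - c) ^ 2 + c ^ 2 / μ * ∑ i ∈ s, inner ℝ (v i) e ^ 2 := by
  set u := ridgeInv μ s v e with hu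
  set w := (c / μ) • e - u with hw
  have h := (by positivity : (0 : ℝ) ≤ μ * _).trans (le_inner_ridgeOp_self μ s v w)
  have hAu : ridgeOp μ s v u = e := ridgeOp_ridgeInv hμ s v e
  have e1 : inner ℝ (ridgeOp μ s v e) u = 1 := by
    rw [inner_ridgeOp_comm, hAu, real_inner_self_eq_norm_sq, he]; norm_num
  have e2 := inner_ridgeOp_self μ s v e
  rw [hw] at h
  simp only [map_sub, map_smul, inner_sub_left, inner_sub_right, inner_smul_left,
    inner_smul_right, hAu, e1, e2, he, real_inner_self_eq_norm_sq, RCLike.conj_to_real] at h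
  rw [real_inner_comm u e] at h
  have h' := mul_le_mul_of_nonneg_left h hμ.le
  field_simp at h' ⊢
  nlinarith

end RidgeAlgebra

/-! ### Compactness of rank-one operators, countability of orthonormal families -/

section RankOne

theorem isCompactOperator_rankOne {E : Type*} [NormedAddCommGroup E] [InnerProductSpace ℝ E]
    (u w : E) :
    IsCompactOperator (InnerProductSpace.rankOne ℝ u w) := by
  rw [InnerProductSpace.rankOne_def']
  exact (isCompactOperator_of_locallyCompactSpace_rng
    (ContinuousLinearMap.toSpanSingleton ℝ u)).comp_clm _

/-- Distinct orthonormal vectors are at distance `√2`, so they form a discrete subset. Countability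
later permits the exchange of the sum over the basis with the integral over the sample. -/
theorem countable_of_orthonormal {E : Type*} [NormedAddCommGroup E] [InnerProductSpace ℝ E]
    [TopologicalSpace.SeparableSpace E] {κ : Type*} {e : κ → E}
    (he : Orthonormal ℝ e) : Countable κ := by
  have : SecondCountableTopology E := UniformSpace.secondCountable_of_separable E
  have hd : ∀ i j, i ≠ j → 1 ≤ dist (e i) (e j) := fun i j hij => by
    rw [dist_eq_norm]
    have h := norm_sub_sq_real (e i) (e j)
    rw [he.2 hij, he.1, he.1] at h
    nlinarith [norm_nonneg (e i - e j)]
  have : DiscreteTopology (Set.range e) := by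
    refine DiscreteTopology.of_forall_le_dist one_pos ?_
    rintro ⟨_, i, rfl⟩ ⟨_, j, rfl⟩ hij
    exact hd i j fun h => hij (by subst h; rfl)
  have : Countable (Set.range e) := TopologicalSpace.separableSpace_iff_countable.1 inferInstance
  exact (Equiv.ofInjective e he.linearIndependent.injective).countable_iff.2 this

end RankOne

/-! ### The covariance operator and its relation to `L_K` -/

section FeatureOperator

variable {X : Type*} [TopologicalSpace X] [CompactSpace X]
variable {E : Type*} [NormedAddCommGroup E] [InnerProductSpace ℝ E]

/-- The map `u ↦ ⟪φ ·, u⟫` from a Hilbert space to the continuous functions. -/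
def featureOpC (φ : C(X, E)) : E →L[ℝ] C(X, ℝ) :=
  LinearMap.mkContinuous
    { toFun := fun u => ⟨fun x => inner ℝ (φ x) u, by fun_prop⟩
      map_add' := fun u w => by ext x; simp [inner_add_right]
      map_smul' := fun c u => by ext x; simp [inner_smul_right] }
    ‖φ‖
    (fun u => by
      refine (ContinuousMap.norm_le _ (by positivity)).2 fun x => ?_
      simp only [LinearMap.coe_mk, AddHom.coe_mk, ContinuousMap.coe_mk]
      refine (norm_inner_le_norm _ _).trans ?_
      gcongr
      exact φ.norm_coe_le_norm x)

theorem featureOpC_apply (φ : C(X, E)) (u : E) (x : X) :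
    featureOpC φ u x = inner ℝ (φ x) u := rfl

variable [MeasurableSpace X] [BorelSpace X]

/-- The map `u ↦ ⟪φ ·, u⟫` from a Hilbert space to `L²(μ)`. -/
def featureOp (φ : C(X, E)) (μ : Measure X) [IsFiniteMeasure μ] : E →L[ℝ] Lp ℝ 2 μ :=
  ContinuousMap.toLp (E := ℝ) 2 μ ℝ ∘L featureOpC φ

theorem coeFn_featureOp (φ : C(X, E)) (μ : Measure X) [IsFiniteMeasure μ] (u : E) :
    featureOp φ μ u =ᵐ[μ] fun x => inner ℝ (φ x) u :=
  ContinuousMap.coeFn_toLp (p := 2) (𝕜 := ℝ) μ (featureOpC φ u)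

theorem inner_featureOp_left (φ : C(X, E)) (μ : Measure X) [IsFiniteMeasure μ] (u : E)
    (g : Lp ℝ 2 μ) : inner ℝ (featureOp φ μ u) g = ∫ x, inner ℝ (φ x) u * g x ∂μ := by
  rw [L2.inner_def]
  refine integral_congr_ae ?_
  filter_upwards [coeFn_featureOp φ μ u] with x hx
  rw [hx]
  simp [mul_comm]

theorem inner_featureOp (φ : C(X, E)) (μ : Measure X) [IsFiniteMeasure μ] (u w : E) :
    inner ℝ (featureOp φ μ u) (featureOp φ μ w) = ∫ x, inner ℝ (φ x) u * inner ℝ (φ x) w ∂μ := by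
  rw [inner_featureOp_left]
  refine integral_congr_ae ?_
  filter_upwards [coeFn_featureOp φ μ w] with x hx
  rw [hx]

variable [CompleteSpace E]

/-- The covariance operator `∫ φ x ⊗ φ x dμ(x)`. -/
def covOp (φ : C(X, E)) (μ : Measure X) [IsFiniteMeasure μ] : E →L[ℝ] E :=
  (featureOp φ μ).adjoint ∘L featureOp φ μ

theorem inner_covOp (φ : C(X, E)) (μ : Measure X) [IsFiniteMeasure μ] (u w : E) :
    inner ℝ (covOp φ μ u) w = ∫ x, inner ℝ (φ x) u * inner ℝ (φ x) w ∂μ := by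
  rw [← inner_featureOp, covOp, ContinuousLinearMap.comp_apply,
    ContinuousLinearMap.adjoint_inner_left]

theorem isSymmetric_covOp (φ : C(X, E)) (μ : Measure X) [IsFiniteMeasure μ] :
    (covOp φ μ : E →ₗ[ℝ] E).IsSymmetric := fun u w => by
  change inner ℝ (covOp φ μ u) w = inner ℝ u (covOp φ μ w)
  rw [real_inner_comm (covOp φ μ w), inner_covOp, inner_covOp]
  simp [mul_comm]

theorem covOp_eq_integral [SecondCountableTopology X] (φ : C(X, E)) (μ : Measure X)
    [IsFiniteMeasure μ] :
    Integrable (fun x => InnerProductSpace.rankOne ℝ (φ x) (φ x)) μ ∧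
    covOp φ μ = ∫ x, InnerProductSpace.rankOne ℝ (φ x) (φ x) ∂μ := by
  have hc : Continuous fun x => InnerProductSpace.rankOne ℝ (φ x) (φ x) :=
    (((InnerProductSpace.rankOne ℝ (E := E) (F := E)).continuous).clm_apply
      continuous_id).comp φ.continuous
  have hi : Integrable (fun x => InnerProductSpace.rankOne ℝ (φ x) (φ x)) μ := by
    refine Integrable.of_bound hc.aestronglyMeasurable (‖φ‖ * ‖φ‖) (ae_of_all _ fun x => ?_)
    rw [InnerProductSpace.norm_rankOne]
    have := φ.norm_coe_le_norm x
    gcongr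
  refine ⟨hi, ContinuousLinearMap.ext fun u => ext_inner_right ℝ fun w => ?_⟩
  rw [inner_covOp, ContinuousLinearMap.integral_apply hi, real_inner_comm,
    ← integral_inner (hi.apply_continuousLinearMap u)]
  simp [inner_smul_right, real_inner_comm]

/-- The covariance is a mean of rank-one operators, and the compact operators form a closed convex
set. -/
theorem isCompactOperator_covOp [SecondCountableTopology X] (φ : C(X, E)) (μ : Measure X)
    [IsProbabilityMeasure μ] : IsCompactOperator (covOp φ μ) := by
  obtain ⟨hi, h⟩ := covOp_eq_integral φ μ
  rw [h]
  exact (Submodule.convex (compactOperator (RingHom.id ℝ) E E)).integral_mem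
    isClosed_setOfPred_isCompactOperator
    (ae_of_all _ fun x => isCompactOperator_rankOne (φ x) (φ x)) hi

theorem inner_adjoint_featureOp (φ : C(X, E)) (μ : Measure X) [IsFiniteMeasure μ] (g : Lp ℝ 2 μ)
    (x : X) : inner ℝ (φ x) ((featureOp φ μ).adjoint g) = ∫ x', inner ℝ (φ x) (φ x') * g x' ∂μ := by
  rw [ContinuousLinearMap.adjoint_inner_right, inner_featureOp_left]
  simp only [real_inner_comm]

/-- With `A = featureOp φ μ`, the integral operator is `A A*` and the covariance is `A* A`; this
carries spectral information between `L²` and the feature space. -/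
theorem integralOp_eq_comp_adjoint (φ : C(X, E)) (μ : Measure X) [IsFiniteMeasure μ]
    (K : MercerKernel X) (hφ : ∀ x x', inner ℝ (φ x) (φ x') = K x x') :
    integralOp K μ = featureOp φ μ ∘L (featureOp φ μ).adjoint := by
  refine ContinuousLinearMap.ext fun g => ?_
  simp only [integralOp, featureOp, ContinuousLinearMap.comp_apply]
  congr 1
  ext x
  rw [featureOpC_apply, ← featureOp, inner_adjoint_featureOp]
  simp only [hφ]
  rfl

theorem mem_eigenspace_integralOp (φ : C(X, E)) (μ : Measure X) [IsFiniteMeasure μ]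
    (K : MercerKernel X) (hφ : ∀ x x', inner ℝ (φ x) (φ x') = K x x') {t : ℝ} {u : E}
    (hu : u ∈ eigenspace (covOp φ μ) t) :
    featureOp φ μ u ∈ eigenspace (integralOp K μ) t := by
  rw [mem_eigenspace] at hu ⊢
  rw [integralOp_eq_comp_adjoint φ μ K hφ, ← map_smul, ← hu]
  rfl

theorem mem_eigenspace_covOp (φ : C(X, E)) (μ : Measure X) [IsFiniteMeasure μ]
    (K : MercerKernel X) (hφ : ∀ x x', inner ℝ (φ x) (φ x') = K x x') {t : ℝ} {g : Lp ℝ 2 μ}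
    (hg : g ∈ eigenspace (integralOp K μ) t) :
    (featureOp φ μ).adjoint g ∈ eigenspace (covOp φ μ) t := by
  rw [mem_eigenspace] at hg ⊢
  rw [integralOp_eq_comp_adjoint φ μ K hφ] at hg
  rw [← map_smul, ← hg]
  rfl

theorem finiteDimensional_eigenspace {F : Type*} [NormedAddCommGroup F] [InnerProductSpace ℝ F]
    [CompleteSpace F] {T : F →L[ℝ] F} (hT : IsCompactOperator T) {t : ℝ} (ht : t ≠ 0) :
    FiniteDimensional ℝ (eigenspace T t) := by
  have h := ContinuousLinearMap.finite_dimensional_eigenspace hT t ht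
  have e : eigenspace T t = Module.End.eigenspace T.toLinearMap t := by
    ext u
    rw [mem_eigenspace, Module.End.mem_eigenspace_iff]
    rfl
  rwa [e]

/-- On an eigenspace with `t ≠ 0`, both `A` and `A*` are injective, since `A* A` and `A A*` act
there as `t`. Only this inequality is needed to bound a sum over the covariance spectrum by
`tracePow (integralOp K μ)`. -/
theorem finrank_eigenspace_covOp_le [SecondCountableTopology X] (φ : C(X, E)) (μ : Measure X)
    [IsProbabilityMeasure μ] (K : MercerKernel X) (hφ : ∀ x x', inner ℝ (φ x) (φ x') = K x x')
    {t : ℝ} (ht : 0 < t) :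
    Module.finrank ℝ (eigenspace (covOp φ μ) t)
      ≤ Module.finrank ℝ (eigenspace (integralOp K μ) t) := by
  have := finiteDimensional_eigenspace (isCompactOperator_covOp φ μ) ht.ne'
  let A : eigenspace (integralOp K μ) t →ₗ[ℝ] eigenspace (covOp φ μ) t :=
    ((featureOp φ μ).adjoint : Lp ℝ 2 μ →ₗ[ℝ] E).restrict
      fun g hg => mem_eigenspace_covOp φ μ K hφ hg
  let B : eigenspace (covOp φ μ) t →ₗ[ℝ] eigenspace (integralOp K μ) t :=
    (featureOp φ μ : E →ₗ[ℝ] Lp ℝ 2 μ).restrict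
      fun u hu => mem_eigenspace_integralOp φ μ K hφ hu
  have hA : Function.Injective A := (injective_iff_map_eq_zero A).2 fun ⟨g, hg'⟩ hg => by
    have h1 : (featureOp φ μ).adjoint g = 0 := congrArg Subtype.val hg
    have h2 := (mem_eigenspace _ _ _).1 hg'
    rw [integralOp_eq_comp_adjoint φ μ K hφ, ContinuousLinearMap.comp_apply, h1, map_zero] at h2
    exact Subtype.ext ((smul_eq_zero.1 h2.symm).resolve_left ht.ne')
  have hB : Function.Injective B := (injective_iff_map_eq_zero B).2 fun ⟨u, hu'⟩ hu => by
    have h1 : featureOp φ μ u = 0 := congrArg Subtype.val hu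
    have h2 := (mem_eigenspace _ _ _).1 hu'
    rw [covOp, ContinuousLinearMap.comp_apply, h1, map_zero] at h2
    exact Subtype.ext ((smul_eq_zero.1 h2.symm).resolve_left ht.ne')
  -- Finite dimension of the target must come first, since `finrank` of an infinite-dimensional
  -- space is `0`.
  have := FiniteDimensional.of_injective A hA
  exact LinearMap.finrank_le_finrank_of_injective hB

end FeatureOperator

/-! ### Spectral theorem for the covariance -/

section EigenBasis

/-- A compact symmetric operator without negative eigenvalues has a Hilbert basis of eigenvectors,
in which each positive eigenvalue occurs according to its multiplicity. -/
theorem exists_hilbertBasis_eigenvectors.{u} {E : Type u} [NormedAddCommGroup E]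
    [InnerProductSpace ℝ E] [CompleteSpace E] {T : E →L[ℝ] E} (hT : IsCompactOperator T)
    (hT' : (T : E →ₗ[ℝ] E).IsSymmetric) :
    ∃ (κ : Type u) (e : HilbertBasis κ ℝ E) (t : κ → ℝ), (∀ j, T (e j) = t j • e j) ∧
      ∀ F : ℝ → ENNReal, (∀ r ≤ 0, F r = 0) →
        ∑' j, F (t j)
          = ∑' r : Set.Ioi (0 : ℝ), (Module.finrank ℝ (eigenspace T r) : ENNReal) * F r := by
  -- A basis is chosen for every real `r`; it is empty when `r` is not an eigenvalue.
  choose w b hb using fun r : ℝ => exists_hilbertBasis ℝ (eigenspace T r)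
  have hfam : OrthogonalFamily ℝ (fun r : ℝ => eigenspace T r)
      fun r => (eigenspace T r).subtypeₗᵢ := by
    intro r s hrs u v
    have h1 := (mem_eigenspace _ _ _).1 u.2
    have h2 := (mem_eigenspace _ _ _).1 v.2
    have h3 := hT' (u : E) (v : E)
    change inner ℝ (T u) (v : E) = inner ℝ (u : E) (T v) at h3
    rw [h1, h2, inner_smul_left, inner_smul_right] at h3
    have h4 : (r - s) * inner ℝ (u : E) (v : E) = 0 := by
      simp only [RCLike.conj_to_real] at h3; linarith
    exact (mul_eq_zero.1 h4).resolve_left (sub_ne_zero.2 hrs)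
  have ho := hfam.orthonormal_sigma_orthonormal (fun r => (b r).orthonormal)
  have hbot : (Submodule.span ℝ (Set.range fun a : Σ r, w r =>
      (eigenspace T a.1).subtypeₗᵢ (b a.1 a.2)))ᗮ = ⊥ := by
    rw [Submodule.eq_bot_iff]
    intro u hu
    have hu' : u ∈ (⨆ r, Module.End.eigenspace (T : Module.End ℝ E) r)ᗮ := by
      rw [← Submodule.iInf_orthogonal, Submodule.mem_iInf]
      intro r v hv
      have hv' : v ∈ eigenspace T r := (mem_eigenspace _ _ _).2 (Module.End.mem_eigenspace_iff.1 hv)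
      have hs := ((b r).hasSum_repr ⟨v, hv'⟩).mapL (eigenspace T r).subtypeL
      have hs2 := hs.mapL (innerSL ℝ u)
      have hz : ∀ i, innerSL ℝ u ((eigenspace T r).subtypeL ((b r).repr ⟨v, hv'⟩ i • b r i)) = 0 :=
        fun i => by
          have := hu _ (Submodule.subset_span ⟨⟨r, i⟩, rfl⟩)
          simp only [map_smul, smul_eq_mul, innerSL_apply_apply]
          rw [real_inner_comm] at this
          exact mul_eq_zero_of_right _ this
      simp only [hz] at hs2
      have := hs2.unique hasSum_zero
      rw [real_inner_comm]
      exact this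
    rwa [ContinuousLinearMap.orthogonalComplement_iSup_eigenspaces_eq_bot hT hT',
      Submodule.mem_bot] at hu'
  refine ⟨Σ r, w r, HilbertBasis.mkOfOrthogonalEqBot ho hbot, Sigma.fst, fun j => ?_, fun F hF => ?_⟩
  · rw [HilbertBasis.coe_mkOfOrthogonalEqBot]
    exact (mem_eigenspace _ _ _).1 (b j.1 j.2).2
  · rw [ENNReal.tsum_sigma' fun a : Σ r, w r => F a.1]
    -- Since `F` vanishes on `r ≤ 0`, the null space, possibly of infinite dimension, does not
    -- contribute.
    rw [← tsum_subtype_eq_of_support_subset (s := Set.Ioi 0)]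
    · refine tsum_congr fun r => ?_
      have hfin := finiteDimensional_eigenspace hT (ne_of_gt r.2)
      have : Finite (w r) := (b r).orthonormal.linearIndependent.finite
      have := Fintype.ofFinite (w r)
      rw [tsum_fintype]
      change ∑ _ : w r, F r = _
      rw [Finset.sum_const, nsmul_eq_mul, Finset.card_univ,
        Module.finrank_eq_card_basis (b r).toOrthonormalBasis.toBasis]
    · intro r hr
      by_contra hr'
      apply hr
      simp [hF r (not_lt.1 hr')]

end EigenBasis

/-! ### Exchangeability of the sample -/

section SampleSymmetry

theorem measurePreserving_comp_perm {ι Z : Type*} [Fintype ι] [MeasurableSpace Z] (ρ : Measure Z)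
    [SigmaFinite ρ] (σ : Equiv.Perm ι) :
    MeasurePreserving (fun S : ι → Z => S ∘ σ) (Measure.pi fun _ => ρ) (Measure.pi fun _ => ρ) := by
  have h := measurePreserving_piCongrLeft (fun _ : ι => ρ) σ.symm
  convert! h using 1
  ext S i
  have := Equiv.piCongrLeft_apply_apply (P := fun _ : ι => Z) σ.symm S (σ i)
  simp only [Equiv.symm_apply_apply] at this
  exact this.symm

theorem ridgeOp_comp_perm {ι E : Type*} [NormedAddCommGroup E] [InnerProductSpace ℝ E] (μ : ℝ)
    (s : Finset ι) (v : ι → E) (σ : Equiv.Perm ι) :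
    ridgeOp μ s (v ∘ σ) = ridgeOp μ (s.map σ.toEmbedding) v := by
  simp [ridgeOp]

/-- A swap inside `s` preserves the covariance of `s`. With exchangeability, all examples of `s`
therefore have the same expected leverage. -/
theorem leverage_comp_swap {ι E : Type*} [DecidableEq ι] [NormedAddCommGroup E]
    [InnerProductSpace ℝ E] [CompleteSpace E] (μ : ℝ) {s : Finset ι} (v : ι → E) {i k : ι}
    (hi : i ∈ s) (hk : k ∈ s) :
    leverage μ s (v ∘ Equiv.swap i k) k = leverage μ s v i := by
  have hs : s.map (Equiv.swap i k).toEmbedding = s := by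
    refine Finset.map_perm fun x hx => ?_
    by_contra hxs
    exact hx (Equiv.swap_apply_of_ne_of_ne (fun h => hxs (h ▸ hi)) (fun h => hxs (h ▸ hk)))
  rw [leverage, leverage, ridgeInv, ridgeInv, ridgeOp_comp_perm, hs]
  simp

end SampleSymmetry

/-! ### Scalar inequalities for the logarithm -/

/-- Each term is `1 - a/a'` with `a = μ + m t`, `a' = a + t`, hence at most `ln(a'/a)`, and these
logarithms telescope. -/
theorem sum_div_le_log {t μ : ℝ} (ht : 0 ≤ t) (hμ : 0 < μ) (n : ℕ) :
    ∑ m ∈ Finset.range n, t / (μ + (m + 1) * t) ≤ Real.log (1 + n * t / μ) := by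
  induction n with
  | zero => simp
  | succ n ih =>
    rw [Finset.sum_range_succ]
    have h1 : 0 < μ + n * t := by positivity
    have h2 : 0 < μ + (n + 1) * t := by positivity
    have h3 := Real.one_sub_inv_le_log_of_pos (div_pos h2 h1)
    rw [inv_div] at h3
    have e1 : 1 - (μ + n * t) / (μ + (n + 1) * t) = t / (μ + (n + 1) * t) := by
      field_simp; ring
    have e2 : (1 + ((n + 1 : ℕ) : ℝ) * t / μ)
        = (1 + n * t / μ) * ((μ + (n + 1) * t) / (μ + n * t)) := by
      push_cast; field_simp
    rw [e2, Real.log_mul (by positivity) (by positivity), ← e1]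
    linarith

/-- With `u = t/λ`, the first bound splits `ln(1+u)` into powers `b` and `1-b` and uses `ln(1+u) ≤
u` and `t ≤ 1`. The bound by `1/b` follows from `b ln(1+u) = ln((1+u)^b) ≤ ln(1+u^b) ≤ u^b`. -/
theorem log_one_add_le_rpow_mul_logFactor {b lam t : ℝ} (hb : b ∈ Set.Icc (0 : ℝ) 1)
    (hlam : 0 < lam) (ht : 0 < t) (ht1 : t ≤ 1) :
    Real.log (1 + t / lam) ≤ t ^ b / lam ^ b * logFactor b lam := by
  have hu : 0 < t / lam := by positivity
  have hl0 : 0 ≤ Real.log (1 + t / lam) := Real.log_nonneg (by linarith)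
  have hmono : Real.log (1 + t / lam) ≤ Real.log (1 + 1 / lam) := by gcongr
  rw [← Real.div_rpow ht.le hlam.le, logFactor]
  split_ifs with h0
  · simpa [h0] using hmono
  · have hbpos : 0 < b := lt_of_le_of_ne hb.1 (Ne.symm h0)
    rw [mul_min_of_nonneg _ _ (by positivity)]
    refine le_min ?_ ?_
    · have hlu : Real.log (1 + t / lam) ≤ t / lam := by
        have := Real.log_le_sub_one_of_pos (show 0 < 1 + t / lam by positivity)
        linarith
      have hpos : 0 < Real.log (1 + t / lam) := Real.log_pos (by linarith)
      calc Real.log (1 + t / lam)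
          = Real.log (1 + t / lam) ^ b * Real.log (1 + t / lam) ^ (1 - b) := by
            rw [← Real.rpow_add hpos]; simp
        _ ≤ (t / lam) ^ b * Real.log (1 + 1 / lam) ^ (1 - b) := by
            have := hb.2
            gcongr
    · have h1 : b * Real.log (1 + t / lam) ≤ (t / lam) ^ b := by
        rw [← Real.log_rpow (by positivity)]
        have h2 : (1 + t / lam) ^ b ≤ 1 + (t / lam) ^ b := by
          have := Real.rpow_add_le_add_rpow zero_le_one hu.le hb.1 hb.2
          simpa using this
        have h3 := Real.log_le_sub_one_of_pos (show 0 < (1 + t / lam) ^ b by positivity)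
        linarith
      rw [mul_one_div, le_div_iff₀ hbpos]
      linarith

/-! ### Expected leverage in terms of the covariance spectrum -/

section ExpectedLeverage

variable {Z : Type*} [TopologicalSpace Z] [SecondCountableTopology Z] [MeasurableSpace Z]
  [BorelSpace Z]
variable {E : Type*} [NormedAddCommGroup E] [InnerProductSpace ℝ E] [CompleteSpace E]

/-- By symmetry, `m = k + 1` times the expectation is that of the total leverage of the examples `0,
…, k`. The total is expanded in the basis `e`, and each term is bounded through
`one_sub_inner_ridgeInv_le`. -/
theorem lintegral_leverage_le {n : ℕ} (ρ : Measure Z) [IsProbabilityMeasure ρ] {ψ : Z → E}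
    (hψ : Continuous ψ) (hψ1 : ∀ z, ‖ψ z‖ ≤ 1) {κ : Type*} [Countable κ] (e : HilbertBasis κ ℝ E)
    {t : κ → ℝ} (ht : ∀ j, ∫ z, inner ℝ (ψ z) (e j) ^ 2 ∂ρ = t j) {μ : ℝ} (hμ : 0 < μ)
    (k : Fin n) :
    ∫⁻ S : Fin n → Z, ENNReal.ofReal (leverage μ (Finset.Iic k) (ψ ∘ S) k) ∂(Measure.pi fun _ => ρ)
      ≤ ∑' j, ENNReal.ofReal (t j / (μ + ((k : ℕ) + 1) * t j)) := by
  set P : Measure (Fin n → Z) := Measure.pi fun _ => ρ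
  set s := Finset.Iic k with hs
  set m : ℝ := (k : ℕ) + 1 with hm
  have hmpos : 0 < m := by positivity
  have hcard : (s.card : ℝ) = m := by simp [hs, hm]
  have ht0 : ∀ j, 0 ≤ t j := fun j => by rw [← ht]; exact integral_nonneg fun z => sq_nonneg _
  have hcψ : Continuous fun S : Fin n → Z => ψ ∘ S := by
    refine continuous_pi fun i => hψ.comp (continuous_apply i)
  have hcl : ∀ i, Continuous fun S : Fin n → Z => leverage μ s (ψ ∘ S) i :=
    fun i => (continuous_leverage hμ s i).comp hcψ
  have hmeas : ∀ i, Measurable fun S : Fin n → Z => ENNReal.ofReal (leverage μ s (ψ ∘ S) i) :=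
    fun i => (hcl i).measurable.ennreal_ofReal
  have hswap : ∀ i ∈ s, ∫⁻ S, ENNReal.ofReal (leverage μ s (ψ ∘ S) i) ∂P
      = ∫⁻ S, ENNReal.ofReal (leverage μ s (ψ ∘ S) k) ∂P := fun i hi => by
    rw [← (measurePreserving_comp_perm ρ (Equiv.swap i k)).lintegral_comp (hmeas k)]
    refine lintegral_congr fun S => ?_
    rw [← Function.comp_assoc, leverage_comp_swap μ (ψ ∘ S) hi (by simp [hs])]
  have hcj : ∀ j, Continuous fun S : Fin n → Z =>
      1 - μ * inner ℝ (ridgeInv μ s (ψ ∘ S) (e j)) (e j) := fun j => by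
    have : Continuous fun S : Fin n → Z => ridgeInv μ s (ψ ∘ S) :=
      (continuous_ridgeInv hμ s).comp hcψ
    fun_prop
  have hsum : ∀ S : Fin n → Z, ∑ i ∈ s, ENNReal.ofReal (leverage μ s (ψ ∘ S) i)
      = ∑' j, ENNReal.ofReal (1 - μ * inner ℝ (ridgeInv μ s (ψ ∘ S) (e j)) (e j)) := fun S => by
    have h := hasSum_sum_leverage e hμ s (ψ ∘ S)
    rw [← ENNReal.ofReal_sum_of_nonneg fun i _ => leverage_nonneg hμ s _ i, ← h.tsum_eq,
      ENNReal.ofReal_tsum_of_nonneg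
        (fun j => one_sub_inner_ridgeInv_nonneg hμ s _ (e.orthonormal.1 j)) h.summable]
  have hint : ∀ (u : E), Integrable (fun z => inner ℝ (ψ z) u ^ 2) ρ := fun u => by
    refine Integrable.of_bound (by fun_prop) (‖u‖ ^ 2) (ae_of_all _ fun z => ?_)
    rw [norm_pow]
    gcongr
    refine (norm_inner_le_norm _ _).trans ?_
    exact mul_le_of_le_one_left (norm_nonneg _) (hψ1 z)
  have hterm : ∀ j, ∫⁻ S, ENNReal.ofReal
      (1 - μ * inner ℝ (ridgeInv μ s (ψ ∘ S) (e j)) (e j)) ∂P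
      ≤ ENNReal.ofReal m * ENNReal.ofReal (t j / (μ + m * t j)) := fun j => by
    have hd : 0 < μ + m * t j := by have := ht0 j; positivity
    -- This `c` minimizes the expected bound `(1-c)² + c² m t_j / μ`, with minimum `m t_j / (μ + m
    -- t_j)`.
    set c := μ / (μ + m * t j) with hc
    have hi1 : ∀ i, Integrable (fun S : Fin n → Z => inner ℝ (ψ (S i)) (e j) ^ 2) P := fun i =>
      (measurePreserving_eval (fun _ => ρ) i).integrable_comp_of_integrable (hint (e j))
    have hi2 : ∀ i, ∫ S : Fin n → Z, inner ℝ (ψ (S i)) (e j) ^ 2 ∂P = t j := fun i => by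
      rw [← ht j, ← (measurePreserving_eval (fun _ : Fin n => ρ) i).map_eq, integral_map]
      · exact (measurable_pi_apply i).aemeasurable
      · fun_prop
    have hi : Integrable (fun S : Fin n → Z =>
        (1 - c) ^ 2 + c ^ 2 / μ * ∑ i ∈ s, inner ℝ (ψ (S i)) (e j) ^ 2) P :=
      (integrable_const _).add ((integrable_finsetSum _ fun i _ => hi1 i).const_mul _)
    calc ∫⁻ S, ENNReal.ofReal (1 - μ * inner ℝ (ridgeInv μ s (ψ ∘ S) (e j)) (e j)) ∂P
        ≤ ∫⁻ S : Fin n → Z, ENNReal.ofReal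
            ((1 - c) ^ 2 + c ^ 2 / μ * ∑ i ∈ s, inner ℝ (ψ (S i)) (e j) ^ 2) ∂P := by
          refine lintegral_mono fun S => ENNReal.ofReal_le_ofReal ?_
          exact one_sub_inner_ridgeInv_le hμ s (ψ ∘ S) (e.orthonormal.1 j) c
      _ = ENNReal.ofReal ((1 - c) ^ 2 + c ^ 2 / μ * (m * t j)) := by
          rw [← ofReal_integral_eq_lintegral_ofReal hi (ae_of_all _ fun S => by positivity),
            integral_add (integrable_const _)
              ((integrable_finsetSum _ fun i _ => hi1 i).const_mul _),
            integral_const_mul, integral_finsetSum _ fun i _ => hi1 i]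
          simp [hi2, hcard]
      _ = ENNReal.ofReal m * ENNReal.ofReal (t j / (μ + m * t j)) := by
          rw [← ENNReal.ofReal_mul hmpos.le]
          congr 1
          rw [hc]
          field_simp
          ring
  have hmain : ENNReal.ofReal m * ∫⁻ S, ENNReal.ofReal (leverage μ s (ψ ∘ S) k) ∂P
      ≤ ENNReal.ofReal m * ∑' j, ENNReal.ofReal (t j / (μ + m * t j)) := by
    calc ENNReal.ofReal m * ∫⁻ S, ENNReal.ofReal (leverage μ s (ψ ∘ S) k) ∂P
        = ∑ i ∈ s, ∫⁻ S, ENNReal.ofReal (leverage μ s (ψ ∘ S) i) ∂P := by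
          rw [Finset.sum_congr rfl hswap, Finset.sum_const, nsmul_eq_mul, ← hcard]
          simp
      _ = ∑' j, ∫⁻ S, ENNReal.ofReal
            (1 - μ * inner ℝ (ridgeInv μ s (ψ ∘ S) (e j)) (e j)) ∂P := by
          rw [← lintegral_finsetSum _ fun i _ => hmeas i, lintegral_congr hsum, lintegral_tsum]
          exact fun j => (hcj j).measurable.ennreal_ofReal.aemeasurable
      _ ≤ _ := by
          rw [← ENNReal.tsum_mul_left]
          exact ENNReal.tsum_le_tsum hterm
  exact (ENNReal.mul_le_mul_iff_right (by simpa using hmpos) ENNReal.ofReal_ne_top).1 hmain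

theorem lintegral_sum_leverage_le {n : ℕ} (ρ : Measure Z) [IsProbabilityMeasure ρ] {ψ : Z → E}
    (hψ : Continuous ψ) (hψ1 : ∀ z, ‖ψ z‖ ≤ 1) {κ : Type*} [Countable κ] (e : HilbertBasis κ ℝ E)
    {t : κ → ℝ} (ht : ∀ j, ∫ z, inner ℝ (ψ z) (e j) ^ 2 ∂ρ = t j) {μ : ℝ} (hμ : 0 < μ) :
    ∑ k : Fin n, ∫⁻ S : Fin n → Z,
        ENNReal.ofReal (leverage μ (Finset.Iic k) (ψ ∘ S) k) ∂(Measure.pi fun _ => ρ)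
      ≤ ∑' j, ENNReal.ofReal (Real.log (1 + n * t j / μ)) := by
  have ht0 : ∀ j, 0 ≤ t j := fun j => by rw [← ht]; exact integral_nonneg fun z => sq_nonneg _
  calc _ ≤ ∑ k : Fin n, ∑' j, ENNReal.ofReal (t j / (μ + ((k : ℕ) + 1) * t j)) :=
        Finset.sum_le_sum fun k _ => lintegral_leverage_le ρ hψ hψ1 e ht hμ k
    _ = ∑' j, ∑ k : Fin n, ENNReal.ofReal (t j / (μ + ((k : ℕ) + 1) * t j)) :=
        (Summable.tsum_finsetSum fun _ _ => ENNReal.summable).symm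
    _ ≤ _ := by
        refine ENNReal.tsum_le_tsum fun j => ?_
        have h0 := ht0 j
        rw [← ENNReal.ofReal_sum_of_nonneg fun k _ => by positivity,
          Fin.sum_univ_eq_sum_range fun k : ℕ => t j / (μ + ((k : ℕ) + 1) * t j)]
        exact ENNReal.ofReal_le_ofReal (sum_div_le_log h0 hμ n)

end ExpectedLeverage

/-! ### Total expected leverage against `Tr[L_K^b]` -/

section TraceBound

variable {X : Type*} [TopologicalSpace X] [CompactSpace X] [SecondCountableTopology X]
  [MeasurableSpace X] [BorelSpace X]
variable {E : Type*} [NormedAddCommGroup E] [InnerProductSpace ℝ E] [CompleteSpace E]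

theorem sum_lintegral_leverage_le_tracePow [TopologicalSpace.SeparableSpace E] (φ : C(X, E))
    (hφ1 : ∀ x, ‖φ x‖ ≤ 1) (K : MercerKernel X) (hφ : ∀ x x', inner ℝ (φ x) (φ x') = K x x')
    (ρ : Measure (X × ℝ)) [IsProbabilityMeasure ρ] {b lam : ℝ} (hb : b ∈ Set.Icc (0 : ℝ) 1)
    (hlam : 0 < lam) {n : ℕ} (hn : 1 ≤ n) :
    ∑ k : Fin n, ∫⁻ S : Fin n → X × ℝ,
        ENNReal.ofReal (leverage (lam * n) (Finset.Iic k) (fun i => φ (S i).1) k)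
          ∂(Measure.pi fun _ => ρ)
      ≤ tracePow (integralOp K ρ.fst) b * ENNReal.ofReal (logFactor b lam / lam ^ b) := by
  obtain ⟨κ, e, t, he, hF⟩ := exists_hilbertBasis_eigenvectors
    (isCompactOperator_covOp φ ρ.fst) (isSymmetric_covOp φ ρ.fst)
  have : Countable κ := countable_of_orthonormal e.orthonormal
  have hn' : (0 : ℝ) < n := by exact_mod_cast hn
  have ht : ∀ j, ∫ z : X × ℝ, inner ℝ (φ z.1) (e j) ^ 2 ∂ρ = t j := fun j => by
    have h1 := inner_covOp φ ρ.fst (e j) (e j)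
    rw [he, inner_smul_left, real_inner_self_eq_norm_sq, e.orthonormal.1 j, Measure.fst,
      integral_map measurable_fst.aemeasurable (by fun_prop)] at h1
    simp only [sq, ← h1]
    simp
  have ht1 : ∀ j, t j ≤ 1 := fun j => by
    rw [← ht j]
    calc ∫ z : X × ℝ, inner ℝ (φ z.1) (e j) ^ 2 ∂ρ ≤ ∫ _ : X × ℝ, (1 : ℝ) ∂ρ := by
          refine integral_mono_of_nonneg (ae_of_all _ fun z => sq_nonneg _)
            (integrable_const _) (ae_of_all _ fun z => ?_)
          have h := norm_inner_le_norm (𝕜 := ℝ) (φ z.1) (e j)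
          rw [e.orthonormal.1 j, mul_one] at h
          exact (sq_le_one_iff_abs_le_one _).2 (h.trans (hφ1 _))
      _ = 1 := by simp
  have hcont : Continuous fun z : X × ℝ => φ z.1 := by fun_prop
  refine (lintegral_sum_leverage_le ρ hcont (fun z => hφ1 z.1) e ht
    (show 0 < lam * n by positivity)).trans ?_
  -- The cutoff at `0` is needed for `b = 0`, where `0 ^ 0 = 1` would count the null space.
  set F : ℝ → ENNReal := fun r =>
    if 0 < r then ENNReal.ofReal (r ^ b) * ENNReal.ofReal (logFactor b lam / lam ^ b) else 0
    with hFdef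
  calc ∑' j, ENNReal.ofReal (Real.log (1 + n * t j / (lam * n)))
      ≤ ∑' j, F (t j) := by
        refine ENNReal.tsum_le_tsum fun j => ?_
        have e1 : n * t j / (lam * n) = t j / lam := by field_simp
        rw [e1, hFdef]
        dsimp only
        split_ifs with h
        · rw [← ENNReal.ofReal_mul (by positivity)]
          refine ENNReal.ofReal_le_ofReal ?_
          refine (log_one_add_le_rpow_mul_logFactor hb hlam h (ht1 j)).trans_eq ?_
          ring
        · have h0 : 0 ≤ t j := by rw [← ht]; exact integral_nonneg fun z => sq_nonneg _
          simp [le_antisymm (not_lt.1 h) h0]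
    _ = ∑' r : Set.Ioi (0 : ℝ),
          (Module.finrank ℝ (eigenspace (covOp φ ρ.fst) r) : ENNReal) * F r :=
        hF F fun r hr => if_neg (not_lt.2 hr)
    _ ≤ _ := by
        rw [tracePow, ← ENNReal.tsum_mul_right]
        refine ENNReal.tsum_le_tsum fun r => ?_
        have hr : 0 < (r : ℝ) := r.2
        rw [hFdef]
        simp only [hr, if_true, ← mul_assoc]
        gcongr
        exact_mod_cast finrank_eigenspace_covOp_le φ ρ.fst K hφ hr

end TraceBound

/-! ### Approximation error under the source condition -/

section SourceBound

/-- Weighted AM-GM gives `t^{2β} λ^{1-2β} ≤ 2β t + (1-2β) λ ≤ t + λ`. Here `β ≤ 1/2` enters. -/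
theorem mul_rpow_div_le {t lam β : ℝ} (ht : 0 < t) (hlam : 0 < lam) (hβ0 : 0 < β)
    (hβ : β ≤ 1 / 2) : lam * (t ^ β * t ^ β / (t + lam)) ≤ lam ^ (2 * β) := by
  have h := Real.geom_mean_le_arith_mean2_weighted (show 0 ≤ 2 * β by linarith)
    (show 0 ≤ 1 - 2 * β by linarith) ht.le hlam.le (by ring)
  have h2 : t ^ (2 * β) * lam ^ (1 - 2 * β) ≤ t + lam := by nlinarith
  have e1 : t ^ β * t ^ β = t ^ (2 * β) := by rw [← Real.rpow_add ht]; ring_nf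
  have e2 : lam = lam ^ (2 * β) * lam ^ (1 - 2 * β) := by rw [← Real.rpow_add hlam]; simp
  rw [e1, ← mul_div_assoc, div_le_iff₀ (by positivity)]
  calc lam * t ^ (2 * β) = lam ^ (2 * β) * (t ^ (2 * β) * lam ^ (1 - 2 * β)) := by
        conv_lhs => rw [e2]
        ring
    _ ≤ _ := by gcongr

variable {E F : Type*} [NormedAddCommGroup E] [InnerProductSpace ℝ E] [CompleteSpace E]
  [NormedAddCommGroup F] [InnerProductSpace ℝ F] [CompleteSpace F]

theorem inner_starProjection_eigenspace_of_ne {T : F →L[ℝ] F} (hT : (T : F →ₗ[ℝ] F).IsSymmetric)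
    {r s : ℝ} (hrs : r ≠ s) (u v : F) :
    inner ℝ ((eigenspace T r).starProjection u) ((eigenspace T s).starProjection v) = 0 := by
  have h1 := (mem_eigenspace T r _).1 ((eigenspace T r).starProjection_apply_mem u)
  have h2 := (mem_eigenspace T s _).1 ((eigenspace T s).starProjection_apply_mem v)
  have h3 := hT ((eigenspace T r).starProjection u) ((eigenspace T s).starProjection v)
  simp only [ContinuousLinearMap.coe_coe, h1, h2, inner_smul_left, inner_smul_right,
    RCLike.conj_to_real] at h3
  have h4 : (r - s) * inner ℝ ((eigenspace T r).starProjection u)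
      ((eigenspace T s).starProjection v) = 0 := by linarith
  exact (mul_eq_zero.1 h4).resolve_left (sub_ne_zero.2 hrs)

theorem sum_norm_sq_starProjection_eigenspace_le {T : F →L[ℝ] F}
    (hT : (T : F →ₗ[ℝ] F).IsSymmetric) (g : F) (s : Finset (Set.Ioi (0 : ℝ))) :
    ∑ t ∈ s, ‖(eigenspace T t).starProjection g‖ ^ 2 ≤ ‖g‖ ^ 2 := by
  classical
  set p := ∑ t ∈ s, (eigenspace T t).starProjection g with hp
  have h1 : inner ℝ g p = ∑ t ∈ s, ‖(eigenspace T t).starProjection g‖ ^ 2 := by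
    rw [hp, inner_sum]
    refine Finset.sum_congr rfl fun t _ => ?_
    have h := (eigenspace T t).starProjection_inner_eq_zero g _
      ((eigenspace T t).starProjection_apply_mem g)
    rw [inner_sub_left, real_inner_self_eq_norm_sq] at h
    linarith
  have h2 : ‖p‖ ^ 2 = ∑ t ∈ s, ‖(eigenspace T t).starProjection g‖ ^ 2 := by
    rw [← real_inner_self_eq_norm_sq, hp, sum_inner]
    refine Finset.sum_congr rfl fun t ht => ?_
    rw [inner_sum, Finset.sum_eq_single t]
    · exact real_inner_self_eq_norm_sq _
    · exact fun r _ hr => inner_starProjection_eigenspace_of_ne hT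
        (fun h => hr (Subtype.ext h.symm)) _ _
    · exact fun h => absurd ht h
  rw [← h1]
  have h3 := real_inner_le_norm g p
  rw [← h2] at h1
  nlinarith [norm_nonneg p, norm_nonneg g, sq_nonneg (‖g‖ - ‖p‖)]

/-- Tikhonov regularization of a target that satisfies a source condition. -/
theorem exists_regularized_approx (A : E →L[ℝ] F) (f : F) {lam : ℝ} (hlam : 0 < lam) :
    ∃ u : E, ∀ β : ℝ, 0 < β → β ≤ 1 / 2 → ∀ g : F, f = powApply (A ∘L A.adjoint) β g →
      lam * ‖u‖ ^ 2 + ‖A u - f‖ ^ 2 ≤ lam ^ (2 * β) * ‖g‖ ^ 2 := by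
  set T := A ∘L A.adjoint with hTdef
  have hTin : ∀ x y : F, inner ℝ (T x) y = inner ℝ (A.adjoint x) (A.adjoint y) := fun x y => by
    rw [hTdef, ContinuousLinearMap.comp_apply, ContinuousLinearMap.adjoint_inner_right]
  have hT : (T : F →ₗ[ℝ] F).IsSymmetric := fun x y => by
    change inner ℝ (T x) y = inner ℝ x (T y)
    rw [hTin, real_inner_comm (T y) x, hTin, real_inner_comm]
  have hunit : IsUnit (T + lam • (1 : F →L[ℝ] F)) := by
    refine ContinuousLinearMap.isUnit_of_forall_le_norm_inner_map _ (c := ⟨lam, hlam.le⟩) hlam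
      fun x => ?_
    refine le_trans ?_ (le_abs_self _)
    change ‖x‖ ^ 2 * lam ≤ inner ℝ (T x + lam • x) x
    rw [inner_add_left, hTin, real_inner_self_eq_norm_sq, inner_smul_left,
      real_inner_self_eq_norm_sq, RCLike.conj_to_real]
    nlinarith [sq_nonneg ‖A.adjoint x‖]
  obtain ⟨w, hw⟩ : ∃ w, T w + lam • w = f := by
    obtain ⟨w, hw⟩ := (ContinuousLinearMap.isUnit_iff_bijective.1 hunit).2 f
    exact ⟨w, hw⟩
  -- The witness `A* (A A* + λ)⁻¹ f` is the Tikhonov solution. It is fixed before `β` and `g`, so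
  -- that one `u` serves all source elements.
  refine ⟨A.adjoint w, fun β hβ0 hβ g hg => ?_⟩
  have hAw : A (A.adjoint w) - f = -(lam • w) := by
    rw [← hw]; change T w - _ = _; abel
  have hval : lam * ‖A.adjoint w‖ ^ 2 + ‖A (A.adjoint w) - f‖ ^ 2 = lam * inner ℝ f w := by
    rw [hAw, norm_neg, norm_smul, mul_pow, ← real_inner_self_eq_norm_sq, ← hTin, ← hw,
      inner_add_left, inner_smul_left, real_inner_self_eq_norm_sq, RCLike.conj_to_real,
      Real.norm_eq_abs, sq_abs]
    ring
  rw [hval]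
  by_cases hs : Summable fun t : Set.Ioi (0 : ℝ) =>
      (t : ℝ) ^ β • (eigenspace T t).starProjection g
  · have hsum : HasSum (fun t : Set.Ioi (0 : ℝ) =>
        (t : ℝ) ^ β • (eigenspace T t).starProjection g) f := by
      rw [hg]; exact hs.hasSum
    have hPf : ∀ t : Set.Ioi (0 : ℝ), inner ℝ ((eigenspace T t).starProjection g) f
        = (t : ℝ) ^ β * ‖(eigenspace T t).starProjection g‖ ^ 2 := fun t => by
      have h1 := hsum.mapL (innerSL ℝ ((eigenspace T t).starProjection g))
      have h2 := hasSum_single (f := fun s : Set.Ioi (0 : ℝ) =>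
        innerSL ℝ ((eigenspace T t).starProjection g)
          ((s : ℝ) ^ β • (eigenspace T s).starProjection g)) t fun s hs => by
        rw [map_smul, innerSL_apply_apply, inner_starProjection_eigenspace_of_ne hT
          (fun h => hs (Subtype.ext h.symm)), smul_zero]
      rw [innerSL_apply_apply] at h1
      rw [h1.unique h2, map_smul, innerSL_apply_apply, real_inner_self_eq_norm_sq, smul_eq_mul]
    -- Since `(T + λ) w = f`, symmetry of `T` divides the component of `f` along `P_t g` by `t + λ`.
    have hPw : ∀ t : Set.Ioi (0 : ℝ), inner ℝ w ((eigenspace T t).starProjection g)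
        = (t : ℝ) ^ β / (t + lam) * ‖(eigenspace T t).starProjection g‖ ^ 2 := fun t => by
      have ht : 0 < (t : ℝ) := t.2
      have h1 := (mem_eigenspace T t _).1 ((eigenspace T t).starProjection_apply_mem g)
      have h2 := hPf t
      rw [← hw, inner_add_right, inner_smul_right] at h2
      have h3 := hT ((eigenspace T t).starProjection g) w
      change inner ℝ (T _) w = inner ℝ _ (T w) at h3
      rw [← h3, h1, inner_smul_left, RCLike.conj_to_real, ← add_mul] at h2
      rw [real_inner_comm, div_mul_eq_mul_div, eq_div_iff (by positivity), ← h2, mul_comm]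
    have h1 := (hsum.mapL (innerSL ℝ w)).mul_left lam
    rw [innerSL_apply_apply, real_inner_comm] at h1
    refine hasSum_le_of_sum_le h1 fun s => ?_
    calc ∑ t ∈ s, lam * innerSL ℝ w ((t : ℝ) ^ β • (eigenspace T t).starProjection g)
        ≤ ∑ t ∈ s, lam ^ (2 * β) * ‖(eigenspace T t).starProjection g‖ ^ 2 := by
          refine Finset.sum_le_sum fun t _ => ?_
          rw [map_smul, innerSL_apply_apply, hPw, smul_eq_mul]
          calc _ = lam * ((t : ℝ) ^ β * (t : ℝ) ^ β / (t + lam))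
                * ‖(eigenspace T t).starProjection g‖ ^ 2 := by ring
            _ ≤ _ := by
                gcongr
                exact mul_rpow_div_le t.2 hlam hβ0 hβ
      _ ≤ lam ^ (2 * β) * ‖g‖ ^ 2 := by
          rw [← Finset.mul_sum]
          gcongr
          exact sum_norm_sq_starProjection_eigenspace_le hT g s
  -- A divergent series has `tsum` equal to `0`, and the bound is then trivial.
  · have h0 : f = 0 := by rw [hg, powApply, tsum_eq_zero_of_not_summable hs]
    rw [h0, inner_zero_left, mul_zero]
    positivity

end SourceBound

/-! ### Truncation as projection onto `[-Y, Y]` -/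

section Truncation

theorem truncate_eq_max_min {Y : ℝ} (hY : 0 ≤ Y) (z : ℝ) : truncate Y z = max (-Y) (min Y z) := by
  rw [truncate]
  rcases lt_trichotomy z 0 with h | h | h
  · rw [Real.sign_of_neg h, abs_of_neg h, min_eq_right (h.le.trans hY), mul_neg_one,
      ← max_neg_neg, neg_neg]
  · simp [h, hY]
  · rw [Real.sign_of_pos h, abs_of_pos h, mul_one, max_eq_right]
    exact le_min (by linarith) (by linarith)

theorem continuous_truncate {Y : ℝ} (hY : 0 ≤ Y) : Continuous (truncate Y) := by
  simp only [funext (truncate_eq_max_min hY)]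
  fun_prop

theorem abs_truncate_le {Y : ℝ} (hY : 0 ≤ Y) (z : ℝ) : |truncate Y z| ≤ Y := by
  rw [truncate_eq_max_min hY, abs_le]
  exact ⟨le_max_left _ _, max_le (by linarith) (min_le_left _ _)⟩

theorem truncate_sub_sq_le {Y y : ℝ} (hy : y ∈ Set.Icc (-Y) Y) (z : ℝ) :
    (truncate Y z - y) ^ 2 ≤ (z - y) ^ 2 := by
  have hY : 0 ≤ Y := by linarith [hy.1, hy.2]
  rw [truncate_eq_max_min hY, sq_le_sq, abs_le]
  have h1 := hy.1
  have h2 := hy.2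
  have h3 := le_abs_self (z - y)
  have h4 := neg_abs_le (z - y)
  have h5 := abs_nonneg (z - y)
  constructor
  · rcases le_total Y z with h | h
    · have := le_max_right (-Y) (min Y z)
      rw [min_eq_left h] at this ⊢
      linarith
    · have := le_max_right (-Y) (min Y z)
      rw [min_eq_right h] at this ⊢
      linarith
  · rw [sub_le_iff_le_add]
    exact max_le (by linarith) ((min_le_right _ _).trans (by linarith))

theorem truncate_sub_sq_le_four {Y y : ℝ} (hy : y ∈ Set.Icc (-Y) Y) (z : ℝ) :
    (truncate Y z - y) ^ 2 ≤ 4 * Y ^ 2 := by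
  have hY : 0 ≤ Y := by linarith [hy.1, hy.2]
  have h := abs_le.1 (abs_truncate_le hY z)
  have : (truncate Y z - y) ^ 2 ≤ (2 * Y) ^ 2 := by
    rw [sq_le_sq, abs_of_nonneg (show 0 ≤ 2 * Y by linarith), abs_le]
    constructor <;> linarith [h.1, h.2, hy.1, hy.2]
  linarith

end Truncation

/-! ### Regression function and bias-variance decomposition -/

section Risk

variable {X : Type*} [MeasurableSpace X]

theorem stronglyMeasurable_regressionFun (ρ : Measure (X × ℝ)) [IsFiniteMeasure ρ] :
    StronglyMeasurable (regressionFun ρ) :=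
  StronglyMeasurable.integral_kernel_prod_right' (κ := ρ.condKernel)
    (f := fun p : X × ℝ => p.2) measurable_snd.stronglyMeasurable

theorem ae_condKernel_mem_Icc {ρ : Measure (X × ℝ)} [IsFiniteMeasure ρ] {Y : ℝ}
    (hY : ∀ᵐ z ∂ρ, z.2 ∈ Set.Icc (-Y) Y) :
    ∀ᵐ x ∂ρ.fst, ∀ᵐ y ∂(ρ.condKernel x), y ∈ Set.Icc (-Y) Y := by
  rw [← ρ.disintegrate ρ.condKernel] at hY
  exact Measure.ae_ae_of_ae_compProd hY

theorem ae_abs_regressionFun_le {ρ : Measure (X × ℝ)} [IsFiniteMeasure ρ] {Y : ℝ}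
    (hY : ∀ᵐ z ∂ρ, z.2 ∈ Set.Icc (-Y) Y) : ∀ᵐ x ∂ρ.fst, |regressionFun ρ x| ≤ Y := by
  filter_upwards [ae_condKernel_mem_Icc hY] with x hx
  have := norm_integral_le_of_norm_le_const (μ := ρ.condKernel x) (f := fun y : ℝ => y) (C := Y)
    (hx.mono fun y hy => abs_le.2 hy)
  simpa [regressionFun] using this

/-- The bias-variance decomposition of the risk. -/
theorem risk_eq_add_integral_sq {ρ : Measure (X × ℝ)} [IsFiniteMeasure ρ] {Y C : ℝ}
    (hY : ∀ᵐ z ∂ρ, z.2 ∈ Set.Icc (-Y) Y) {f : X → ℝ} (hf : Measurable f) (hfC : ∀ x, |f x| ≤ C) :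
    risk ρ f = risk ρ (regressionFun ρ) + ∫ x, (f x - regressionFun ρ x) ^ 2 ∂ρ.fst := by
  set m := regressionFun ρ with hm
  have hmm : Measurable m := (stronglyMeasurable_regressionFun ρ).measurable
  have hmY : ∀ᵐ z ∂ρ, |m z.1| ≤ Y :=
    ae_of_ae_map measurable_fst.aemeasurable (ae_abs_regressionFun_le hY)
  have hbd : ∀ᵐ z ∂ρ, |f z.1 - m z.1| ≤ C + Y ∧ |m z.1 - z.2| ≤ Y + Y := by
    filter_upwards [hY, hmY] with z h1 h2
    exact ⟨(abs_sub _ _).trans (add_le_add (hfC _) h2),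
      (abs_sub _ _).trans (add_le_add h2 (abs_le.2 h1))⟩
  have hi1 : Integrable (fun z : X × ℝ => (m z.1 - z.2) ^ 2) ρ := by
    refine Integrable.of_bound (by fun_prop) ((Y + Y) ^ 2) ?_
    filter_upwards [hbd] with z hz
    rw [norm_pow]
    exact pow_le_pow_left₀ (norm_nonneg _) hz.2 2
  have hi2 : Integrable (fun z : X × ℝ => (f z.1 - m z.1) ^ 2) ρ := by
    refine Integrable.of_bound (by fun_prop) ((C + Y) ^ 2) ?_
    filter_upwards [hbd] with z hz
    rw [norm_pow]
    exact pow_le_pow_left₀ (norm_nonneg _) hz.1 2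
  have hi3 : Integrable (fun z : X × ℝ => (f z.1 - m z.1) * (m z.1 - z.2)) ρ := by
    refine Integrable.of_bound (by fun_prop) ((C + Y) * (Y + Y)) ?_
    filter_upwards [hbd] with z hz
    rw [norm_mul]
    exact mul_le_mul hz.1 hz.2 (norm_nonneg _) ((abs_nonneg _).trans hz.1)
  -- Conditionally on `x`, the first factor is constant and the second has mean zero.
  have hcross : ∫ z : X × ℝ, (f z.1 - m z.1) * (m z.1 - z.2) ∂ρ = 0 := by
    rw [← Measure.integral_condKernel hi3]
    refine integral_eq_zero_of_ae ?_
    filter_upwards [ae_condKernel_mem_Icc hY] with x hx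
    have hix : Integrable (fun y : ℝ => y) (ρ.condKernel x) :=
      Integrable.of_bound (by fun_prop) Y (hx.mono fun y hy => abs_le.2 hy)
    change ∫ y, (f x - m x) * (m x - y) ∂(ρ.condKernel x) = 0
    rw [integral_const_mul, integral_sub (integrable_const _) hix]
    simp [hm, regressionFun]
  have hfst : ∫ x, (f x - m x) ^ 2 ∂ρ.fst = ∫ z : X × ℝ, (f z.1 - m z.1) ^ 2 ∂ρ := by
    rw [Measure.fst, integral_map measurable_fst.aemeasurable (by fun_prop)]
  have e : ∀ z : X × ℝ, (f z.1 - z.2) ^ 2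
      = (m z.1 - z.2) ^ 2 + ((f z.1 - m z.1) ^ 2 + 2 * ((f z.1 - m z.1) * (m z.1 - z.2))) :=
    fun z => by ring
  have hi4 := hi3.const_mul 2
  rw [risk, risk, hfst]
  simp only [e]
  have hi5 := integral_add hi1 (hi2.add hi4)
  simp only [Pi.add_apply] at hi5
  rw [hi5, integral_add hi2 hi4, integral_const_mul, hcross]
  ring

end Risk

/-! ### The canonical feature map and the candidates `f_k` -/

section KernelFeature

variable {X : Type*} (H : Type*) [NormedAddCommGroup H] [InnerProductSpace ℝ H] [CompleteSpace H]
  [RKHS ℝ H X ℝ]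

theorem inner_kerFun_one (x : X) (f : H) : inner ℝ (RKHS.kerFun H x 1) f = f x := by
  simp

variable [TopologicalSpace X]

theorem inner_kerFun_kerFun {K : MercerKernel X}
    (hH : ∀ x x' : X, RKHS.kernel H x x' 1 = K x x') (x x' : X) :
    inner ℝ (RKHS.kerFun H x 1) (RKHS.kerFun H x' 1) = K x x' := by
  rw [inner_kerFun_one, RKHS.kerFun_apply, hH]

/-- The canonical feature map `x ↦ K(x, ·)` of a reproducing kernel Hilbert space. -/
def kernelFeature {K : MercerKernel X} (hH : ∀ x x' : X, RKHS.kernel H x x' 1 = K x x') :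
    C(X, H) where
  toFun x := RKHS.kerFun H x 1
  continuous_toFun := by
    refine continuous_iff_continuousAt.2 fun x => ?_
    rw [ContinuousAt, tendsto_iff_norm_sub_tendsto_zero]
    -- This is `‖K(y,·) - K(x,·)‖`, by the reproducing property.
    have hc : Continuous fun y => √(K y y - 2 * K y x + K x x) := by
      have hK := K.continuous_toFun
      have h1 : Continuous fun y => K y y := hK.comp (continuous_id.prodMk continuous_id)
      have h2 : Continuous fun y => K y x := hK.comp (continuous_id.prodMk continuous_const)
      fun_prop
    have h := hc.tendsto x
    have h0 : K x x - 2 * K x x + K x x = 0 := by ring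
    rw [h0, Real.sqrt_zero] at h
    refine h.congr fun y => ?_
    rw [← inner_kerFun_kerFun H hH y y, ← inner_kerFun_kerFun H hH y x,
      ← inner_kerFun_kerFun H hH x x, real_inner_self_eq_norm_sq, real_inner_self_eq_norm_sq,
      ← norm_sub_sq_real, Real.sqrt_sq (norm_nonneg _)]

variable {H}
variable {K : MercerKernel X} (hH : ∀ x x' : X, RKHS.kernel H x x' 1 = K x x')

theorem inner_kernelFeature_left (x : X) (f : H) : inner ℝ (kernelFeature H hH x) f = f x :=
  inner_kerFun_one H x f

theorem inner_kernelFeature (x x' : X) :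
    inner ℝ (kernelFeature H hH x) (kernelFeature H hH x') = K x x' :=
  inner_kerFun_kerFun H hH x x'

-- A function orthogonal to every `K(x,·)` vanishes pointwise, so the continuous image of the
-- separable `X` spans a dense subspace.
include hH in
theorem separableSpace_of_kernel [TopologicalSpace.SeparableSpace X] :
    TopologicalSpace.SeparableSpace H := by
  have h1 : (Submodule.span ℝ (Set.range (kernelFeature H hH))).topologicalClosure = ⊤ := by
    rw [Submodule.topologicalClosure_eq_top_iff, Submodule.eq_bot_iff]
    intro f hf
    ext x
    rw [← inner_kernelFeature_left hH x f, hf _ (Submodule.subset_span ⟨x, rfl⟩)]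
    simp
  have h2 := (TopologicalSpace.isSeparable_range (kernelFeature H hH).continuous).span (R := ℝ)
  have h3 := h2.closure
  rw [← Submodule.topologicalClosure_coe, h1, Submodule.top_coe] at h3
  exact TopologicalSpace.isSeparable_univ_iff.1 h3

variable {n : ℕ}

theorem ridgeObjective_eq_ridgeCost (hn : 1 ≤ n) (lam : ℝ) (S : Fin n → X × ℝ) (k : Fin n)
    (f : H) :
    ridgeObjective H lam S k f = 1 / (n : ℝ) * ridgeCost (lam * n) (Finset.Iio k)
      (fun i => kernelFeature H hH (S i).1) (fun i => (S i).2) f := by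
  have hn' : (n : ℝ) ≠ 0 := by positivity
  simp only [ridgeObjective, ridgeCost, inner_kernelFeature_left]
  field_simp

/-- For `λ > 0` the minimizer is unique, so the least-norm clause and the choice by
`Classical.epsilon` leave no freedom. The factor `n` in `λn` clears the `1/n` of the objective. -/
theorem ridge_eq_ridgeSol (hn : 1 ≤ n) {lam : ℝ} (hlam : 0 < lam) (S : Fin n → X × ℝ)
    (k : Fin n) :
    ridge H lam S k = ridgeSol (lam * n) (Finset.Iio k) (fun i => kernelFeature H hH (S i).1)
      (fun i => (S i).2) := by
  have hn' : (0 : ℝ) < n := by exact_mod_cast hn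
  have hμ : 0 < lam * n := by positivity
  set p := ridgeSol (lam * n) (Finset.Iio k) (fun i => kernelFeature H hH (S i).1)
    (fun i => (S i).2)
  have hmin : ∀ f, ridgeObjective H lam S k f ≤ ridgeObjective H lam S k p → f = p := by
    intro f hf
    rw [ridgeObjective_eq_ridgeCost hH hn, ridgeObjective_eq_ridgeCost hH hn] at hf
    have h1 := le_of_mul_le_mul_left hf (by positivity)
    have h2 := ridgeCost_ridgeSol_add_le hμ (Finset.Iio k) (fun i => kernelFeature H hH (S i).1)
      (fun i => (S i).2) f
    have h3 : lam * n * ‖f - p‖ ^ 2 ≤ 0 := by linarith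
    have h4 : ‖f - p‖ ^ 2 ≤ 0 := nonpos_of_mul_nonpos_right h3 hμ
    have h5 : ‖f - p‖ = 0 := by nlinarith [norm_nonneg (f - p)]
    exact sub_eq_zero.1 (norm_eq_zero.1 h5)
  have hp : ∀ g, ridgeObjective H lam S k p ≤ ridgeObjective H lam S k g := fun g => by
    rw [ridgeObjective_eq_ridgeCost hH hn, ridgeObjective_eq_ridgeCost hH hn]
    have h2 := ridgeCost_ridgeSol_add_le hμ (Finset.Iio k) (fun i => kernelFeature H hH (S i).1)
      (fun i => (S i).2) g
    have : 0 ≤ lam * n * ‖g - p‖ ^ 2 := by positivity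
    gcongr
    linarith
  have hex : ∃ f, IsRidgeSolution H lam S k f :=
    ⟨p, hp, fun g hg => (hmin g (hg p)) ▸ le_rfl⟩
  exact hmin _ ((Classical.epsilon_spec hex).1 p)

include hH in
theorem continuous_ridge (hn : 1 ≤ n) {lam : ℝ} (hlam : 0 < lam) (k : Fin n) :
    Continuous fun S : Fin n → X × ℝ => ridge H lam S k := by
  have hn' : (0 : ℝ) < n := by exact_mod_cast hn
  have hμ : 0 < lam * n := by positivity
  simp only [ridge_eq_ridgeSol hH hn hlam, ridgeSol]
  have h1 : Continuous fun (S : Fin n → X × ℝ) (i : Fin n) => kernelFeature H hH (S i).1 := by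
    fun_prop
  have h2 := (continuous_ridgeInv hμ (Finset.Iio k)).comp h1
  refine h2.clm_apply (continuous_finsetSum _ fun i _ => ?_)
  fun_prop

include hH in
theorem continuous_ridge_apply (hn : 1 ≤ n) {lam : ℝ} (hlam : 0 < lam) (k : Fin n) :
    Continuous fun p : (Fin n → X × ℝ) × X => ridge H lam p.1 k p.2 := by
  simp only [← inner_kernelFeature_left hH]
  have := continuous_ridge hH hn hlam k
  fun_prop

end KernelFeature

/-! ### Replacing example `k` by a fresh one -/

/-- The objective for `k` sums over `Finset.Iio k` only, so the `k`-th example is unseen and can act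
as test point. -/
theorem ridge_update {X H : Type*} [NormedAddCommGroup H] [InnerProductSpace ℝ H] [RKHS ℝ H X ℝ]
    {n : ℕ} (lam : ℝ) (S : Fin n → X × ℝ) (k : Fin n) (z : X × ℝ) :
    ridge H lam (Function.update S k z) k = ridge H lam S k := by
  have h : ridgeObjective H lam (Function.update S k z) k = ridgeObjective H lam S k := by
    funext f
    simp only [ridgeObjective]
    congr 2
    refine Finset.sum_congr rfl fun i hi => ?_
    rw [Function.update_of_ne (Finset.mem_Iio.1 hi).ne]
  have h2 : IsRidgeSolution H lam (Function.update S k z) k = IsRidgeSolution H lam S k := by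
    funext f
    simp only [IsRidgeSolution, h]
  rw [ridge, ridge, h2]

theorem measurePreserving_update {ι Z : Type*} [Fintype ι] [DecidableEq ι] [MeasurableSpace Z]
    (ρ : Measure Z) [IsProbabilityMeasure ρ] (k : ι) :
    MeasurePreserving (fun p : (ι → Z) × Z => Function.update p.1 k p.2)
      ((Measure.pi fun _ => ρ).prod ρ) (Measure.pi fun _ => ρ) := by
  have hm : Measurable fun p : (ι → Z) × Z => Function.update p.1 k p.2 := by
    refine measurable_pi_iff.2 fun i => ?_
    rcases eq_or_ne i k with rfl | h
    · simpa using measurable_snd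
    · simp only [Function.update_of_ne h]
      fun_prop
  refine ⟨hm, (Measure.pi_eq fun s hs => ?_).symm⟩
  rw [Measure.map_apply hm (MeasurableSet.univ_pi hs)]
  have e : (fun p : (ι → Z) × Z => Function.update p.1 k p.2) ⁻¹' Set.univ.pi s
      = (Set.univ.pi (Function.update s k Set.univ)) ×ˢ s k := by
    ext p
    simp only [Set.mem_preimage, Set.mem_pi, Set.mem_univ, true_imp_iff, Set.mem_prod]
    constructor
    · intro h
      refine ⟨fun i => ?_, by simpa using h k⟩
      rcases eq_or_ne i k with rfl | hi
      · simp
      · simpa [hi] using h i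
    · rintro ⟨h1, h2⟩ i
      rcases eq_or_ne i k with rfl | hi
      · simpa using h2
      · simpa [hi] using h1 i
  rw [e, Measure.prod_prod, Measure.pi_pi, ← Finset.mul_prod_erase _ _ (Finset.mem_univ k),
    ← Finset.mul_prod_erase (a := k) _ (fun i => ρ (s i)) (Finset.mem_univ k),
    Function.update_self, measure_univ, one_mul, mul_comm]
  congr 1
  refine Finset.prod_congr rfl fun i hi => ?_
  rw [Function.update_of_ne (Finset.ne_of_mem_erase hi)]

/-! ### Cumulative loss of the truncated predictors -/

section TruncatedLoss

/-- The squared loss on `z` of the truncated predictor trained on the first `k` examples of `S`. -/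
def truncatedLoss {X : Type*} (H : Type*) [NormedAddCommGroup H] [InnerProductSpace ℝ H]
    [RKHS ℝ H X ℝ] {n : ℕ} (lam Y : ℝ) (k : Fin n) (S : Fin n → X × ℝ) (z : X × ℝ) : ℝ :=
  (truncate Y (ridge H lam S k z.1) - z.2) ^ 2

variable {X : Type*} {H : Type*} [NormedAddCommGroup H] [InnerProductSpace ℝ H] [RKHS ℝ H X ℝ]
variable {n : ℕ} {lam Y : ℝ}

theorem truncatedLoss_nonneg (k : Fin n) (S : Fin n → X × ℝ) (z : X × ℝ) :
    0 ≤ truncatedLoss H lam Y k S z := sq_nonneg _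

theorem truncatedLoss_le (k : Fin n) (S : Fin n → X × ℝ) {z : X × ℝ}
    (hz : z.2 ∈ Set.Icc (-Y) Y) : truncatedLoss H lam Y k S z ≤ 4 * Y ^ 2 :=
  truncate_sub_sq_le_four hz _

theorem risk_ktrOutput [MeasurableSpace X] (ρ : Measure (X × ℝ)) (σ : Equiv.Perm (Fin n))
    (k : Fin n) (S : Fin n → X × ℝ) :
    risk ρ (ktrOutput H lam Y S σ k) = ∫ z, truncatedLoss H lam Y k (S ∘ σ) z ∂ρ := rfl

variable [TopologicalSpace X] [CompleteSpace H] {K : MercerKernel X}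
  (hH : ∀ x x' : X, RKHS.kernel H x x' 1 = K x x')

include hH in
theorem continuous_truncatedLoss (hn : 1 ≤ n) (hlam : 0 < lam) (hY0 : 0 ≤ Y) (k : Fin n) :
    Continuous fun p : (Fin n → X × ℝ) × (X × ℝ) => truncatedLoss H lam Y k p.1 p.2 := by
  have h1 : Continuous fun p : (Fin n → X × ℝ) × (X × ℝ) => (p.1, p.2.1) := by fun_prop
  have h2 := (continuous_truncate hY0).comp ((continuous_ridge_apply hH hn hlam k).comp h1)
  have h3 : Continuous fun p : (Fin n → X × ℝ) × (X × ℝ) => p.2.2 := by fun_prop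
  exact (h2.sub h3).pow 2

include hH in
theorem continuous_truncatedLoss_self (hn : 1 ≤ n) (hlam : 0 < lam) (hY0 : 0 ≤ Y) (k : Fin n) :
    Continuous fun S : Fin n → X × ℝ => truncatedLoss H lam Y k S (S k) := by
  have h1 : Continuous fun S : Fin n → X × ℝ => (S, S k) := by fun_prop
  have h2 := (continuous_truncatedLoss hH hn hlam hY0 k).comp h1
  simpa only [Function.comp_def] using h2

theorem norm_kernelFeature_le (hK : ∀ x : X, K x x ≤ 1) (x : X) : ‖kernelFeature H hH x‖ ≤ 1 := by
  have h := inner_kernelFeature hH x x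
  rw [real_inner_self_eq_norm_sq] at h
  have := hK x
  rw [← h] at this
  exact (sq_le_one_iff₀ (norm_nonneg _)).1 this

/-- Both bounds start from the regret inequality. The first splits each loss with weights `1 - h_k`
and `h_k`, using the untruncated loss on one part and `4Y²` on the other. The second uses `(1 +
1/μ)(1 - h_k) ≥ 1`, which follows from `h_k ≤ 1/(1+μ)`. -/
theorem sum_truncatedLoss_le (hn : 1 ≤ n) (hlam : 0 < lam) (hK : ∀ x : X, K x x ≤ 1)
    {S : Fin n → X × ℝ} (hS : ∀ i, (S i).2 ∈ Set.Icc (-Y) Y) (u : H) :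
    (∑ k, truncatedLoss H lam Y k S (S k)
      ≤ lam * n * ‖u‖ ^ 2 + ∑ i, (u (S i).1 - (S i).2) ^ 2
        + 4 * Y ^ 2 * ∑ k, leverage (lam * n) (Finset.Iic k)
            (fun i => kernelFeature H hH (S i).1) k) ∧
    ∑ k, truncatedLoss H lam Y k S (S k)
      ≤ (1 + 1 / (lam * n)) * (lam * n * ‖u‖ ^ 2 + ∑ i, (u (S i).1 - (S i).2) ^ 2) := by
  have hn' : (0 : ℝ) < n := by exact_mod_cast hn
  have hμ : 0 < lam * n := by positivity
  have hreg := sum_sq_le_ridgeCost hμ (fun i => kernelFeature H hH (S i).1)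
    (fun i => (S i).2) u
  simp only [ridgeCost, inner_kernelFeature_left, ← ridge_eq_ridgeSol hH hn hlam] at hreg
  set h : Fin n → ℝ := fun k => leverage (lam * n) (Finset.Iic k)
    (fun i => kernelFeature H hH (S i).1) k with hh
  have h0 : ∀ k, 0 ≤ h k := fun k => leverage_nonneg hμ _ _ k
  have h1 : ∀ k, h k ≤ 1 / (1 + lam * n) := fun k =>
    leverage_le hμ (by simp) (norm_kernelFeature_le hH hK _)
  have hlt : ∀ k, h k ≤ 1 := fun k => (h1 k).trans (by
    rw [div_le_one (by positivity)]; linarith)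
  have hl1 : ∀ k, truncatedLoss H lam Y k S (S k) ≤ (ridge H lam S k (S k).1 - (S k).2) ^ 2 :=
    fun k => truncate_sub_sq_le (hS k) _
  have hl2 : ∀ k, truncatedLoss H lam Y k S (S k) ≤ 4 * Y ^ 2 :=
    fun k => truncate_sub_sq_le_four (hS k) _
  constructor
  · refine le_trans ?_ (add_le_add_left hreg _)
    rw [Finset.mul_sum, ← Finset.sum_add_distrib]
    refine Finset.sum_le_sum fun k _ => ?_
    have e1 := mul_le_mul_of_nonneg_left (hl1 k) (sub_nonneg.2 (hlt k))
    have e2 := mul_le_mul_of_nonneg_left (hl2 k) (h0 k)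
    change _ ≤ (1 - h k) * _ + 4 * Y ^ 2 * h k
    linarith
  · refine le_trans ?_ (mul_le_mul_of_nonneg_left hreg (by positivity))
    rw [Finset.mul_sum]
    refine Finset.sum_le_sum fun k _ => (hl1 k).trans ?_
    change _ ≤ _ * ((1 - h k) * _)
    rw [← mul_assoc]
    refine le_mul_of_one_le_left (sq_nonneg _) ?_
    have e1 : (1 + 1 / (lam * n)) * (1 - 1 / (1 + lam * n)) = 1 := by
      field_simp
      ring
    have := h1 k
    refine e1.symm.le.trans ?_
    exact mul_le_mul_of_nonneg_left (by linarith) (by positivity)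

end TruncatedLoss

/-! ### Expectations: comparator, online-to-batch, leverage -/

section Oracle

variable {X : Type*} [TopologicalSpace X] [MeasurableSpace X] [BorelSpace X]
variable {H : Type*} [NormedAddCommGroup H] [InnerProductSpace ℝ H] [CompleteSpace H]
  [RKHS ℝ H X ℝ]
variable {K : MercerKernel X} (hH : ∀ x x' : X, RKHS.kernel H x x' 1 = K x x')
variable {ρ : Measure (X × ℝ)} {Y lam : ℝ}

include hH in
theorem exists_regularized_risk_le [CompactSpace X] [IsProbabilityMeasure ρ]
    (hY : ∀ᵐ z ∂ρ, z.2 ∈ Set.Icc (-Y) Y) {β : ℝ} (hβ0 : 0 < β) (hβ : β ≤ 1 / 2)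
    (hsource : SourceCondition K ρ.fst β (regressionFun ρ)) (hlam : 0 < lam) :
    ∃ u : H, lam * ‖u‖ ^ 2 + risk ρ u ≤ risk ρ (regressionFun ρ)
      + lam ^ (2 * β) * sourceNorm K ρ.fst β (regressionFun ρ) ^ 2 := by
  set φ := kernelFeature H hH with hφ
  obtain ⟨g₀, hg₀⟩ := hsource
  set F := powApply (integralOp K ρ.fst) β g₀ with hF
  change regressionFun ρ =ᵐ[ρ.fst] F at hg₀
  obtain ⟨u, hu⟩ := exists_regularized_approx (featureOp φ ρ.fst) F hlam
  rw [← integralOp_eq_comp_adjoint φ ρ.fst K (inner_kernelFeature hH)] at hu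
  refine ⟨u, ?_⟩
  have hucont : Continuous (u : X → ℝ) := by
    simp only [funext fun x => (inner_kernelFeature_left hH x u).symm]
    fun_prop
  obtain ⟨C, hC⟩ : ∃ C, ∀ x, |u x| ≤ C :=
    ⟨‖featureOpC φ u‖, fun x => by
      rw [← inner_kernelFeature_left hH x u]; exact (featureOpC φ u).norm_coe_le_norm x⟩
  have hnorm : ‖featureOp φ ρ.fst u - F‖ ^ 2 = ∫ x, (u x - regressionFun ρ x) ^ 2 ∂ρ.fst := by
    rw [← real_inner_self_eq_norm_sq, L2.inner_def]
    refine integral_congr_ae ?_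
    filter_upwards [hg₀, coeFn_featureOp φ ρ.fst u, Lp.coeFn_sub (featureOp φ ρ.fst u) F]
      with x h1 h2 h3
    rw [h3, Pi.sub_apply, h1, h2, inner_kernelFeature_left]
    simp [sq]
  have hall : ∀ g ∈ sourceElements K ρ.fst β (regressionFun ρ),
      lam * ‖u‖ ^ 2 + ‖featureOp φ ρ.fst u - F‖ ^ 2 ≤ lam ^ (2 * β) * ‖g‖ ^ 2 := fun g hg => by
    refine hu β hβ0 hβ g (Lp.ext ?_)
    exact hg₀.symm.trans hg
  have hle : lam * ‖u‖ ^ 2 + ‖featureOp φ ρ.fst u - F‖ ^ 2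
      ≤ lam ^ (2 * β) * sourceNorm K ρ.fst β (regressionFun ρ) ^ 2 := by
    have hp : 0 < lam ^ (2 * β) := Real.rpow_pos_of_pos hlam _
    -- The infimum need not be known to be attained: a square root turns the bound into a lower
    -- bound for every `‖g‖`, hence for the infimum.
    rw [← div_le_iff₀' hp]
    refine (Real.sqrt_le_left ?_).1 ?_
    · exact Real.sInf_nonneg (by rintro _ ⟨g, _, rfl⟩; exact norm_nonneg g)
    · refine le_csInf ⟨_, g₀, hg₀, rfl⟩ ?_
      rintro _ ⟨g, hg, rfl⟩
      rw [Real.sqrt_le_left (norm_nonneg g), div_le_iff₀' hp]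
      exact hall g hg
  rw [risk_eq_add_integral_sq hY hucont.measurable hC, ← hnorm]
  linarith

variable {n : ℕ} [SecondCountableTopology X]

include hH in
theorem integrable_truncatedLoss [IsProbabilityMeasure ρ]
    (hY : ∀ᵐ z ∂ρ, z.2 ∈ Set.Icc (-Y) Y) (hn : 1 ≤ n) (hlam : 0 < lam) (hY0 : 0 ≤ Y)
    (k : Fin n) :
    Integrable (fun p : (Fin n → X × ℝ) × (X × ℝ) => truncatedLoss H lam Y k p.1 p.2)
      ((Measure.pi fun _ => ρ).prod ρ) := by
  refine Integrable.of_bound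
    (continuous_truncatedLoss hH hn hlam hY0 k).aestronglyMeasurable (4 * Y ^ 2) ?_
  filter_upwards [Measure.quasiMeasurePreserving_snd.ae hY] with p hp
  rw [Real.norm_of_nonneg (truncatedLoss_nonneg _ _ _)]
  exact truncatedLoss_le _ _ hp

include hH in
theorem integrable_risk_truncated [IsProbabilityMeasure ρ]
    (hY : ∀ᵐ z ∂ρ, z.2 ∈ Set.Icc (-Y) Y) (hn : 1 ≤ n) (hlam : 0 < lam) (hY0 : 0 ≤ Y)
    (σ : Equiv.Perm (Fin n)) (k : Fin n) :
    Integrable (fun S : Fin n → X × ℝ => risk ρ (ktrOutput H lam Y S σ k))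
      (Measure.pi fun _ => ρ) := by
  simp only [risk_ktrOutput]
  exact (measurePreserving_comp_perm ρ σ).integrable_comp_of_integrable
    (integrable_truncatedLoss hH hY hn hlam hY0 k).integral_prod_left

include hH in
/-- The expected risk of the predictor trained on the first `k` examples is its expected loss on
the next one. -/
theorem integral_risk_truncated [IsProbabilityMeasure ρ]
    (hY : ∀ᵐ z ∂ρ, z.2 ∈ Set.Icc (-Y) Y) (hn : 1 ≤ n) (hlam : 0 < lam) (hY0 : 0 ≤ Y)
    (σ : Equiv.Perm (Fin n)) (k : Fin n) :
    ∫ S : Fin n → X × ℝ, risk ρ (ktrOutput H lam Y S σ k) ∂(Measure.pi fun _ => ρ)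
      = ∫ S : Fin n → X × ℝ, truncatedLoss H lam Y k S (S k) ∂(Measure.pi fun _ => ρ) := by
  have hi := integrable_truncatedLoss hH hY hn hlam hY0 k
  have hσ := measurePreserving_comp_perm ρ σ
  have hu := measurePreserving_update ρ k
  have h1 := integral_map (φ := fun S : Fin n → X × ℝ => S ∘ σ)
    (f := fun S => ∫ z, truncatedLoss H lam Y k S z ∂ρ) hσ.measurable.aemeasurable
    (by rw [hσ.map_eq]; exact hi.integral_prod_left.aestronglyMeasurable)
  have h2 := integral_map (μ := (Measure.pi fun _ => ρ).prod ρ)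
    (φ := fun p : (Fin n → X × ℝ) × (X × ℝ) => Function.update p.1 k p.2)
    (f := fun S => truncatedLoss H lam Y k S (S k)) hu.measurable.aemeasurable
    (continuous_truncatedLoss_self hH hn hlam hY0 k).aestronglyMeasurable
  rw [hσ.map_eq] at h1
  rw [hu.map_eq] at h2
  simp only [risk_ktrOutput]
  -- Both sides become integrals over a sample and an independent `z`: on the left `z` is the test
  -- point, on the right it overwrites example `k`, which does not change the predictor.
  rw [← h1, h2, ← integral_prod _ hi]
  refine integral_congr_ae (ae_of_all _ fun p => ?_)
  simp only [truncatedLoss, ridge_update, Function.update_self]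

-- The sample law is permutation invariant, so every `σ` contributes equally and the average over
-- permutations disappears.
variable (H) in
theorem integral_ktrMeanRisk [IsProbabilityMeasure ρ]
    (hH : ∀ x x' : X, RKHS.kernel H x x' 1 = K x x')
    (hY : ∀ᵐ z ∂ρ, z.2 ∈ Set.Icc (-Y) Y) (hn : 1 ≤ n) (hlam : 0 < lam) (hY0 : 0 ≤ Y) :
    Integrable (fun S : Fin n → X × ℝ => ktrMeanRisk H ρ lam Y S) (Measure.pi fun _ => ρ) ∧
    ∫ S : Fin n → X × ℝ, ktrMeanRisk H ρ lam Y S ∂(Measure.pi fun _ => ρ)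
      = 1 / (n : ℝ) * ∑ k : Fin n,
        ∫ S : Fin n → X × ℝ, truncatedLoss H lam Y k S (S k) ∂(Measure.pi fun _ => ρ) := by
  have hi := integrable_risk_truncated hH hY hn hlam hY0
  have hi2 : ∀ σ : Equiv.Perm (Fin n), Integrable (fun S : Fin n → X × ℝ =>
      1 / (n : ℝ) * ∑ k : Fin n, risk ρ (ktrOutput H lam Y S σ k)) (Measure.pi fun _ => ρ) :=
    fun σ => (integrable_finsetSum _ fun k _ => hi σ k).const_mul _
  constructor
  · exact (integrable_finsetSum _ fun σ _ => hi2 σ).const_mul _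
  · simp only [ktrMeanRisk]
    rw [integral_const_mul, integral_finsetSum _ fun σ _ => hi2 σ]
    simp only [integral_const_mul, integral_finsetSum _ fun k _ => hi _ k,
      integral_risk_truncated hH hY hn hlam hY0, Finset.sum_const, Finset.card_univ,
      Fintype.card_perm, Fintype.card_fin, nsmul_eq_mul]
    have : (n.factorial : ℝ) ≠ 0 := by positivity
    field_simp

theorem sum_integral_leverage_le [CompactSpace X] [IsProbabilityMeasure ρ]
    (hK : ∀ x : X, K x x ≤ 1) {b : ℝ} (hb : b ∈ Set.Icc (0 : ℝ) 1) (htrace : tracePow (integralOp K ρ.fst) b < ⊤) (hn : 1 ≤ n)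
    (hlam : 0 < lam) :
    (∀ k : Fin n, Integrable (fun S : Fin n → X × ℝ => leverage (lam * n) (Finset.Iic k)
        (fun i => kernelFeature H hH (S i).1) k) (Measure.pi fun _ => ρ)) ∧
    ∑ k : Fin n, ∫ S : Fin n → X × ℝ, leverage (lam * n) (Finset.Iic k)
        (fun i => kernelFeature H hH (S i).1) k ∂(Measure.pi fun _ => ρ)
      ≤ (tracePow (integralOp K ρ.fst) b).toReal * (logFactor b lam / lam ^ b) := by
  have hn' : (0 : ℝ) < n := by exact_mod_cast hn
  have hμ : 0 < lam * n := by positivity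
  have hφ1 := norm_kernelFeature_le hH hK
  have hi : ∀ k : Fin n, Integrable (fun S : Fin n → X × ℝ => leverage (lam * n) (Finset.Iic k)
      (fun i => kernelFeature H hH (S i).1) k) (Measure.pi fun _ => ρ) := fun k => by
    have h1 : Continuous fun (S : Fin n → X × ℝ) (i : Fin n) => kernelFeature H hH (S i).1 := by
      fun_prop
    refine Integrable.of_bound
      ((continuous_leverage hμ (Finset.Iic k) k).comp h1).aestronglyMeasurable
      (1 / (1 + lam * n)) (ae_of_all _ fun S => ?_)
    rw [Real.norm_of_nonneg (leverage_nonneg hμ _ _ k)]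
    exact leverage_le hμ (by simp) (hφ1 _)
  refine ⟨hi, ?_⟩
  have hsep := separableSpace_of_kernel hH
  have hlog : 0 ≤ logFactor b lam := by
    have : 0 ≤ Real.log (1 + 1 / lam) := Real.log_nonneg (by
      have : 0 < 1 / lam := by positivity
      linarith)
    have hb0 := hb.1
    rw [logFactor]
    split_ifs
    · exact this
    · positivity
  have h := sum_lintegral_leverage_le_tracePow (kernelFeature H hH) hφ1 K
    (inner_kernelFeature hH) ρ hb hlam hn
  have hnn : ∀ k : Fin n, 0 ≤ ∫ S : Fin n → X × ℝ, leverage (lam * n) (Finset.Iic k)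
      (fun i => kernelFeature H hH (S i).1) k ∂(Measure.pi fun _ => ρ) :=
    fun k => integral_nonneg fun S => leverage_nonneg hμ _ _ k
  simp only [← ofReal_integral_eq_lintegral_ofReal (hi _)
    (ae_of_all _ fun S => leverage_nonneg hμ _ _ _)] at h
  -- Finiteness of the trace is essential here, because `toReal` sends `⊤` to `0`.
  rw [← ENNReal.ofReal_sum_of_nonneg fun k _ => hnn k, ← ENNReal.ofReal_toReal htrace.ne,
    ← ENNReal.ofReal_mul ENNReal.toReal_nonneg] at h
  exact (ENNReal.ofReal_le_ofReal_iff (by positivity)).1 h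

end Oracle
end KTR

end

/-! ### The risk bound -/

theorem theorem1 {d : ℕ} (X : Set (EuclideanSpace ℝ (Fin d))) [CompactSpace X]
    (K : KTR.MercerKernel X) (hK : ∀ x : X, K x x ≤ 1)
    {H : Type*} [NormedAddCommGroup H] [InnerProductSpace ℝ H] [CompleteSpace H] [RKHS ℝ H X ℝ]
    (hH : ∀ x x' : X, RKHS.kernel H x x' 1 = K x x')
    (ρ : Measure (X × ℝ)) [IsProbabilityMeasure ρ]
    (Y : ℝ) (hY : ∀ᵐ z ∂ρ, z.2 ∈ Set.Icc (-Y) Y)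
    (β : ℝ) (hβ0 : 0 < β) (hβ : β ≤ 1 / 2)
    (hsource : KTR.SourceCondition K ρ.fst β (KTR.regressionFun ρ))
    (b : ℝ) (hb : b ∈ Set.Icc (0 : ℝ) 1)
    (htrace : KTR.tracePow (KTR.integralOp K ρ.fst) b < ⊤)
    (lam : ℝ) (hlam : 0 < lam) (n : ℕ) (hn : 1 ≤ n) :
    Integrable (fun S : Fin n → X × ℝ => KTR.ktrMeanRisk H ρ lam Y S)
        (Measure.pi fun _ : Fin n => ρ) ∧
      (∫ S : Fin n → X × ℝ, KTR.ktrMeanRisk H ρ lam Y S ∂(Measure.pi fun _ : Fin n => ρ))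
          - KTR.risk ρ (KTR.regressionFun ρ)
        ≤ lam ^ (2 * β) * KTR.sourceNorm K ρ.fst β (KTR.regressionFun ρ) ^ 2
          + min
            (4 * Y ^ 2 * (KTR.tracePow (KTR.integralOp K ρ.fst) b).toReal / (lam ^ b * n)
              * KTR.logFactor b lam)
            (lam ^ (2 * β - 1) * KTR.sourceNorm K ρ.fst β (KTR.regressionFun ρ) ^ 2 / n
              + KTR.risk ρ (KTR.regressionFun ρ) / (lam * n)) := by
  have hY0 : 0 ≤ Y := by
    obtain ⟨z, hz⟩ := hY.exists
    linarith [hz.1, hz.2]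
  have hn' : (0 : ℝ) < n := by exact_mod_cast hn
  have hμ : 0 < lam * n := by positivity
  obtain ⟨hint, hval⟩ := KTR.integral_ktrMeanRisk H hH hY hn hlam hY0
  refine ⟨hint, ?_⟩
  rw [hval]
  obtain ⟨u, hu⟩ := KTR.exists_regularized_risk_le hH hY hβ0 hβ hsource hlam
  obtain ⟨hlev, hlevsum⟩ := KTR.sum_integral_leverage_le (n := n) hH hK hb htrace hn hlam
  set P : Measure (Fin n → X × ℝ) := Measure.pi fun _ => ρ
  set R := KTR.risk ρ (KTR.regressionFun ρ) with hR
  set N := KTR.sourceNorm K ρ.fst β (KTR.regressionFun ρ)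
  have hS : ∀ᵐ S ∂P, ∀ i, (S i).2 ∈ Set.Icc (-Y) Y :=
    ae_all_iff.2 fun i =>
      (measurePreserving_eval (fun _ : Fin n => ρ) i).quasiMeasurePreserving.ae hY
  have hucont : Continuous (u : X → ℝ) := by
    simp only [funext fun x => (KTR.inner_kernelFeature_left hH x u).symm]
    fun_prop
  have hloss : ∀ k : Fin n, Integrable
      (fun S : Fin n → X × ℝ => KTR.truncatedLoss H lam Y k S (S k)) P := fun k => by
    refine Integrable.of_bound
      (KTR.continuous_truncatedLoss_self hH hn hlam hY0 k).aestronglyMeasurable (4 * Y ^ 2) ?_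
    filter_upwards [hS] with S h
    rw [Real.norm_of_nonneg (KTR.truncatedLoss_nonneg _ _ _)]
    exact KTR.truncatedLoss_le _ _ (h k)
  have hcu : Continuous fun z : X × ℝ => (u z.1 - z.2) ^ 2 := by fun_prop
  have hui : Integrable (fun z : X × ℝ => (u z.1 - z.2) ^ 2) ρ := by
    refine Integrable.of_bound hcu.aestronglyMeasurable
      ((‖KTR.featureOpC (KTR.kernelFeature H hH) u‖ + Y) ^ 2) ?_
    filter_upwards [hY] with z hz
    rw [norm_pow]
    refine pow_le_pow_left₀ (norm_nonneg _) ((norm_sub_le _ _).trans ?_) 2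
    refine add_le_add ?_ (abs_le.2 hz)
    rw [← KTR.inner_kernelFeature_left hH]
    exact (KTR.featureOpC (KTR.kernelFeature H hH) u).norm_coe_le_norm z.1
  have hui2 : ∀ i : Fin n, Integrable (fun S : Fin n → X × ℝ => (u (S i).1 - (S i).2) ^ 2) P :=
    fun i => (measurePreserving_eval (fun _ => ρ) i).integrable_comp_of_integrable hui
  have hui3 : ∀ i : Fin n, ∫ S : Fin n → X × ℝ, (u (S i).1 - (S i).2) ^ 2 ∂P = KTR.risk ρ u :=
    fun i => by
      have he := measurePreserving_eval (fun _ : Fin n => ρ) i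
      have h := integral_map (f := fun z : X × ℝ => (u z.1 - z.2) ^ 2) he.measurable.aemeasurable
        (by rw [he.map_eq]; exact hcu.aestronglyMeasurable)
      rw [he.map_eq] at h
      exact h.symm
  have hci : Integrable (fun S : Fin n → X × ℝ =>
      lam * n * ‖u‖ ^ 2 + ∑ i, (u (S i).1 - (S i).2) ^ 2) P :=
    (integrable_const _).add (integrable_finsetSum _ fun i _ => hui2 i)
  -- With `μ = λn`, the expected ridge cost of the fixed comparator `u` is exactly `n` times its
  -- regularized risk.
  have hcv : ∫ S : Fin n → X × ℝ, (lam * n * ‖u‖ ^ 2 + ∑ i, (u (S i).1 - (S i).2) ^ 2) ∂P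
      = n * (lam * ‖u‖ ^ 2 + KTR.risk ρ u) := by
    rw [integral_add (integrable_const _) (integrable_finsetSum _ fun i _ => hui2 i),
      integral_finsetSum _ fun i _ => hui2 i]
    simp only [hui3, integral_const, probReal_univ, one_smul, Finset.sum_const, Finset.card_univ,
      Fintype.card_fin, nsmul_eq_mul]
    ring
  have hcv2 := mul_le_mul_of_nonneg_left hu hn'.le
  rw [← hcv] at hcv2
  have hb1 : ∑ k : Fin n, ∫ S : Fin n → X × ℝ, KTR.truncatedLoss H lam Y k S (S k) ∂P
      ≤ n * (R + lam ^ (2 * β) * N ^ 2) + 4 * Y ^ 2 *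
        ((KTR.tracePow (KTR.integralOp K ρ.fst) b).toReal * (KTR.logFactor b lam / lam ^ b)) := by
    rw [← integral_finsetSum _ fun k _ => hloss k]
    have hli := (integrable_finsetSum Finset.univ fun k _ => hlev k).const_mul (4 * Y ^ 2)
    refine (integral_mono_ae (integrable_finsetSum _ fun k _ => hloss k) (hci.add hli)
      (hS.mono fun S h => (KTR.sum_truncatedLoss_le hH hn hlam hK h u).1)).trans ?_
    have e := integral_add hci hli
    rw [integral_const_mul, integral_finsetSum _ fun k _ => hlev k] at e
    refine e.trans_le (add_le_add hcv2 ?_)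
    gcongr
  have hb2 : ∑ k : Fin n, ∫ S : Fin n → X × ℝ, KTR.truncatedLoss H lam Y k S (S k) ∂P
      ≤ (1 + 1 / (lam * n)) * (n * (R + lam ^ (2 * β) * N ^ 2)) := by
    rw [← integral_finsetSum _ fun k _ => hloss k]
    refine (integral_mono_ae (integrable_finsetSum _ fun k _ => hloss k) (hci.const_mul _)
      (hS.mono fun S h => (KTR.sum_truncatedLoss_le hH hn hlam hK h u).2)).trans ?_
    rw [integral_const_mul]
    gcongr
  rw [← min_add_add_left]
  refine le_min ?_ ?_
  · have := mul_le_mul_of_nonneg_left hb1 (show 0 ≤ 1 / (n : ℝ) by positivity)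
    have hp : 0 < lam ^ b := Real.rpow_pos_of_pos hlam _
    refine (sub_le_sub_right this R).trans_eq ?_
    field_simp
    ring
  · have := mul_le_mul_of_nonneg_left hb2 (show 0 ≤ 1 / (n : ℝ) by positivity)
    refine (sub_le_sub_right this R).trans_eq ?_
    rw [Real.rpow_sub_one hlam.ne']
    field_simp
    ring
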